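/- Let $M$ be a connected (Hausdorff, finite-dimensional) smooth manifold with a smooth Riemannian metric $\alpha$, let $\nabla^*$ be its Lévi-Civita connection, and let $\beta$ be a smooth one-form on $M$ whose dual vector field $\beta^{\sharp}$ (defined by $\alpha(\beta^\sharp,v)=\beta(v)$) satisfies $|\beta^\sharp|_\alpha<1$ everywhere. Let $F(v)=\sqrt{\alpha(v,v)}+\beta(v)$ be the associated Randers metric, and suppose that $F$ is non-Riemannian, i.e. that $F$ is not the norm of a Riemannian metric on $M$. A (smooth) linear connection $\nabla$ on $M$ is called compatible with $F$ if its parallel transports along smooth curves $\gamma\colon[a,b]\to M$ preserve $F$. Then $M$ admits a linear connection compatible with $F$ if and only if $\beta^{\sharp}$ has constant Riemannian length $K\neq 0$. Suppose that $\beta^\sharp$ has constant Riemannian length $K\neq 0$, and define the tensor field $$A(X,Y)=\frac{\alpha(\nabla^*_X \beta^{\sharp}, Y)}{K^2}\,\beta^{\sharp}-\frac{\alpha(Y, \beta^{\sharp})}{K^2}\,\nabla^*_X \beta^{\sharp}.$$ Then, for every point $p\in M$ and every $X\in T_pM$, the linear map $\iota_XA\colon Y\mapsto A(X,Y)$ is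 the unique minimizer of $|L|^2$ among all linear maps $L\colon T_pM\to T_pM$ with $$\alpha(L(Y),Z)=-\alpha(L(Z),Y)\quad (Y,Z\in T_pM)\qquad\text{and}\qquad L(\beta^\sharp_p)=-\nabla^*_X\beta^\sharp,$$ where $|L|^2=\sum_{i,j}\alpha(e_i,L(e_j))^2$ for an orthonormal basis $(e_i)$ of $T_pM$. Moreover, $\nabla^{\circ}_XY=\nabla^*_XY+A(X,Y)$ is a linear connection compatible with $F$. -/

import Mathlib

open Bundle
open scoped Manifold ContDiff

noncomputable section

namespace Randers

variable {E : Type*} [NormedAddCommGroup E] [NormedSpace ℝ E]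
  {H : Type*} [TopologicalSpace H] {I : ModelWithCorners ℝ E H}
  {M : Type*} [TopologicalSpace M] [ChartedSpace H M]

/-! ### Covariant derivative along curves and parallel transport -/

section Connection

variable [IsManifold I 1 M]

/-- The coordinate-constant local vector field around `p`: on the domain of the trivialization of
`TM` given by the preferred chart at `p`, its coordinate vector is `w`. -/
def constField (p : M) (w : E) : Π x : M, TangentSpace I x :=
  fun x ↦ (trivializationAt E (TangentSpace I : M → Type _) p).symm x w

/-- The velocity at time `t` of a curve defined on `s`. -/
def velocityWithin (γ : ℝ → M) (s : Set ℝ) (t : ℝ) : TangentSpace I (γ t) :=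
  mfderivWithin 𝓘(ℝ, ℝ) I γ s t (1 : ℝ)

/-- The coordinates, at time `r`, of the vector field `V` along `γ` in the preferred chart
at `p`. -/
def coordAlong (γ : ℝ → M) (V : Π t : ℝ, TangentSpace I (γ t)) (p : M) (r : ℝ) : E :=
  (trivializationAt E (TangentSpace I : M → Type _) p ⟨γ r, V r⟩).2

/-- The covariant derivative `DV/dt = (dVᵏ/dt + Γᵏᵢⱼ γ'ⁱ Vʲ) ∂ₖ` of a vector field `V` along a
curve `γ` defined on `s`. At each time `t` it is computed in the preferred chart at `γ t`; the
Christoffel term is the covariant derivative, in the direction `γ'(t)`, of the field whose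
coordinates are constantly those of `V t`. -/
def covDerivAlong (cov : CovariantDerivative I E (TangentSpace I : M → Type _))
    (γ : ℝ → M) (V : Π t : ℝ, TangentSpace I (γ t)) (s : Set ℝ) (t : ℝ) : TangentSpace I (γ t) :=
  (trivializationAt E (TangentSpace I : M → Type _) (γ t)).symm (γ t)
      (derivWithin (coordAlong γ V (γ t)) s t)
    + cov (constField (γ t) (coordAlong γ V (γ t) t)) (γ t) (velocityWithin γ s t)

/-- `w ∈ T_{γ(b)} M` is the parallel transport of `v ∈ T_{γ(a)} M` along the curve
`γ : [a, b] → M`: there is a parallel vector field along `γ` with initial value `v` and end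
value `w`. -/
def IsParallelTransport (cov : CovariantDerivative I E (TangentSpace I : M → Type _))
    (γ : ℝ → M) (a b : ℝ) (v : TangentSpace I (γ a)) (w : TangentSpace I (γ b)) : Prop :=
  ∃ V : Π t : ℝ, TangentSpace I (γ t),
    MDifferentiableOn 𝓘(ℝ, ℝ) I.tangent (fun t ↦ (⟨γ t, V t⟩ : TangentBundle I M)) (Set.Icc a b) ∧
    (∀ t ∈ Set.Icc a b, covDerivAlong cov γ V (Set.Icc a b) t = 0) ∧
    V a = v ∧ V b = w

/-- A linear connection is compatible with a function `F : TM → ℝ` if the parallel transports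
along all smooth curves `γ : [a, b] → M` preserve `F`. -/
def IsCompatible (cov : CovariantDerivative I E (TangentSpace I : M → Type _))
    (F : Π x : M, TangentSpace I x → ℝ) : Prop :=
  ∀ (γ : ℝ → M) (a b : ℝ), a < b → ContMDiffOn 𝓘(ℝ, ℝ) I ∞ γ (Set.Icc a b) →
    ∀ (v : TangentSpace I (γ a)) (w : TangentSpace I (γ b)),
      IsParallelTransport cov γ a b v w → F (γ b) w = F (γ a) v

/-- A function on `TM` is Riemannian if it is the norm of a smooth Riemannian metric on `M`. -/
def IsRiemannianNorm (F : Π x : M, TangentSpace I x → ℝ) : Prop :=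
  ∃ g : Bundle.ContMDiffRiemannianMetric I ∞ E (TangentSpace I : M → Type _),
    ∀ (x : M) (v : TangentSpace I x), F x v = √(g.inner x v v)

end Connection

/-! ### Randers metrics on a Riemannian manifold -/

variable [FiniteDimensional ℝ E]

instance (x : M) : FiniteDimensional ℝ (TangentSpace I x) :=
  inferInstanceAs (FiniteDimensional ℝ E)

variable [RiemannianBundle (fun x : M ↦ TangentSpace I x)]

/-- The vector field `β♯` dual to the one-form `β`, i.e. `α(β♯, v) = β(v)`. -/
def sharp (β : Π x : M, TangentSpace I x →L[ℝ] ℝ) (x : M) : TangentSpace I x :=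
  haveI : CompleteSpace (TangentSpace I x) := FiniteDimensional.complete ℝ _
  (InnerProductSpace.toDual ℝ (TangentSpace I x)).symm (β x)

theorem inner_sharp (β : Π x : M, TangentSpace I x →L[ℝ] ℝ) (x : M) (v : TangentSpace I x) :
    inner ℝ (sharp β x) v = β x v := by
  have : CompleteSpace (TangentSpace I x) := FiniteDimensional.complete ℝ _
  exact InnerProductSpace.toDual_symm_apply

variable (I M) in
/-- The perturbing term of a Randers metric: a smooth one-form `β` on the Riemannian manifold
`M` such that `β♯` has Riemannian length less than one everywhere. -/
structure RandersForm [IsManifold I 1 M] where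
  form : Π x : M, TangentSpace I x →L[ℝ] ℝ
  contMDiff : ContMDiff I (I.prod 𝓘(ℝ, E →L[ℝ] ℝ)) ∞
    (fun x ↦ TotalSpace.mk' (E →L[ℝ] ℝ)
      (E := fun x : M ↦ TangentSpace I x →L[ℝ] Bundle.Trivial M ℝ x) x (form x))
  norm_sharp_lt_one : ∀ x, ‖sharp form x‖ < 1

/-- The Randers metric `F(v) = √(α(v, v)) + β(v)`. -/
def RandersForm.metric [IsManifold I 1 M] (β : RandersForm I M) (x : M)
    (v : TangentSpace I x) : ℝ :=
  √(inner ℝ v v) + β.form x v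

theorem sum_sq_inner_basis_eq {W : Type*} [NormedAddCommGroup W] [InnerProductSpace ℝ W]
    [FiniteDimensional ℝ W] (L : W →ₗ[ℝ] W) {ι κ : Type*} [Fintype ι] [Fintype κ]
    (f : OrthonormalBasis κ ℝ W) (e : OrthonormalBasis ι ℝ W) :
    ∑ i, ∑ j, (inner ℝ (f i) (L (f j))) ^ 2 = ∑ i, ∑ j, (inner ℝ (e i) (L (e j))) ^ 2 := by
  have h1 : ∑ i, ∑ j, (inner ℝ (f i) (L (f j))) ^ 2
      = ∑ i, ∑ j, (inner ℝ (e i) (L (f j))) ^ 2 := by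
    rw [Finset.sum_comm, Finset.sum_comm (γ := ι)]
    refine Finset.sum_congr rfl fun j _ ↦ ?_
    simpa using (f.sum_sq_norm_inner_right (L (f j))).trans
      (e.sum_sq_norm_inner_right (L (f j))).symm
  rw [h1]
  refine Finset.sum_congr rfl fun i _ ↦ ?_
  simp only [← LinearMap.adjoint_inner_left L]
  simpa using (f.sum_sq_norm_inner_left (LinearMap.adjoint L (e i))).trans
    (e.sum_sq_norm_inner_left (LinearMap.adjoint L (e i))).symm

/-- The squared norm of an endomorphism `L` of `T_x M`, as a tensor over the Euclidean space
`(T_x M, α)`: the sum of the squares of its components in an orthonormal basis. -/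
def tensorNormSq {x : M} (L : TangentSpace I x →L[ℝ] TangentSpace I x) : ℝ :=
  ∑ i, ∑ j, (inner ℝ (stdOrthonormalBasis ℝ (TangentSpace I x) i)
    (L (stdOrthonormalBasis ℝ (TangentSpace I x) j))) ^ 2

/-- The norm does not depend on the orthonormal basis. -/
theorem tensorNormSq_eq {x : M} (L : TangentSpace I x →L[ℝ] TangentSpace I x) {ι : Type*}
    [Fintype ι] (e : OrthonormalBasis ι ℝ (TangentSpace I x)) :
    tensorNormSq L = ∑ i, ∑ j, (inner ℝ (e i) (L (e j))) ^ 2 :=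
  sum_sq_inner_basis_eq L.toLinearMap _ e

variable [IsManifold I 1 M]

/-- `L`, in the role of `ι_X A : Y ↦ A(X, Y)`, satisfies the constraints
`α(L Y, Z) = -α(L Z, Y)` and `L β♯ = -∇_X β♯` at the point `x`, where `X ∈ T_x M`. -/
def IsFeasible (cov : CovariantDerivative I E (TangentSpace I : M → Type _))
    (β : Π x : M, TangentSpace I x →L[ℝ] ℝ) {x : M} (X : TangentSpace I x)
    (L : TangentSpace I x →L[ℝ] TangentSpace I x) : Prop :=
  (∀ Y Z : TangentSpace I x, inner ℝ (L Y) Z = -inner ℝ (L Z) Y) ∧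
  L (sharp β x) = -cov (sharp β) x X

/-- `L` is the unique solution of the problem of minimizing `|L|²` subject to the constraints. -/
def IsUniqueOptimum (cov : CovariantDerivative I E (TangentSpace I : M → Type _))
    (β : Π x : M, TangentSpace I x →L[ℝ] ℝ) {x : M} (X : TangentSpace I x)
    (L : TangentSpace I x →L[ℝ] TangentSpace I x) : Prop :=
  IsFeasible cov β X L ∧
  ∀ L' : TangentSpace I x →L[ℝ] TangentSpace I x, IsFeasible cov β X L' → L' ≠ L →
    tensorNormSq L < tensorNormSq L'

/-- `∇α = 0` for the Riemannian metric `α`: `X α(Y, Z) = α(∇_X Y, Z) + α(Y, ∇_X Z)` for all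
vector fields `Y`, `Z` that are differentiable at the point considered. -/
def IsMetric (cov : CovariantDerivative I E (TangentSpace I : M → Type _)) : Prop :=
  ∀ (x : M) (X : TangentSpace I x) (Y Z : Π y : M, TangentSpace I y),
    MDiffAt (T% Y) x → MDiffAt (T% Z) x →
    mvfderiv I (fun y ↦ (inner ℝ (Y y) (Z y) : ℝ)) x X
      = inner ℝ (cov Y x X) (Z x) + inner ℝ (Y x) (cov Z x X)

/-- The Levi-Civita connection: the smooth, metric and torsion-free linear connection. -/
structure IsLeviCivita [IsManifold I 2 M]
    (cov : CovariantDerivative I E (TangentSpace I : M → Type _)) : Prop where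
  smooth : cov.ContMDiffCovariantDerivative ∞
  metric : IsMetric cov
  torsion_free : cov.torsion = 0

end Randers

end

/-! Necessity. Parallel transport of a compatible connection preserves `F`. Transporting `v` to `w`
also transports `-v` to `-w`, so the even part `√α` and the odd part `β` of `F` are preserved
separately along such a pair. Applying this to `v = β♯` at `x` and using Cauchy-Schwarz at the
endpoint `y` gives `|β♯|(x) ≤ |β♯|(y)`; exchanging the points gives equality. Only short curves are
needed, since a locally constant function on a connected manifold is constant. They are segments in
a chart, where the transport equation has small coefficients (`exists_nhds_parallelTransport`,
`exists_norm_sharp_eq`). The value `0` is excluded because then `F = √α` is Riemannian.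

Sufficiency. A metric connection with `β♯` parallel preserves both `α` and `β`, hence `F`
(`isCompatible_of_isMetric`). The Levi-Civita connection, built from the Koszul formula, is metric.
Adding a one-form `A` with values in skew endomorphisms keeps it metric, and `A(X, β♯) = -∇_X β♯`
makes `β♯` parallel. With `|β♯| = K` constant, `∇_X β♯` is orthogonal to `β♯`, so the wedge of `∇_X
β♯` and `β♯`, divided by `K²`, is such an `A`.

Optimality. Two feasible maps differ by a skew `N` with `N β♯ = 0`. Such an `N` is orthogonal to
every wedge containing `β♯`, so `|A + N|² = |A|² + |N|²` (`sum_sq_norm_lt_of_skew`). -/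

noncomputable section

namespace Randers

open scoped Topology

/-! ### Coordinates on the tangent bundle -/

section

variable {E : Type*} [NormedAddCommGroup E] [NormedSpace ℝ E]
  {H : Type*} [TopologicalSpace H] {I : ModelWithCorners ℝ E H}
  {M : Type*} [TopologicalSpace M] [ChartedSpace H M]

section Coordinates

variable [IsManifold I 1 M]

/-- The coordinates of tangent vectors at `x` in the preferred chart at `p`, as a linear map. -/
def coordMap (p x : M) : TangentSpace I x →L[ℝ] E :=
  (trivializationAt E (TangentSpace I : M → Type _) p).continuousLinearMapAt ℝ x

theorem mem_baseSet_self (p : M) :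
    p ∈ (trivializationAt E (TangentSpace I : M → Type _) p).baseSet :=
  FiberBundle.mem_baseSet_trivializationAt' p

theorem eventually_mem_baseSet {p x : M}
    (hx : x ∈ (trivializationAt E (TangentSpace I : M → Type _) p).baseSet) :
    ∀ᶠ y in 𝓝 x, y ∈ (trivializationAt E (TangentSpace I : M → Type _) p).baseSet :=
  (trivializationAt E (TangentSpace I : M → Type _) p).open_baseSet.mem_nhds hx

theorem coordMap_apply {p x : M}
    (hx : x ∈ (trivializationAt E (TangentSpace I : M → Type _) p).baseSet)
    (v : TangentSpace I x) :
    coordMap p x v = (trivializationAt E (TangentSpace I : M → Type _) p ⟨x, v⟩).2 := by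
  rw [coordMap, Trivialization.continuousLinearMapAt_apply,
    Trivialization.coe_linearMapAt_of_mem _ hx]

theorem constField_eq_symmL {p x : M}
    (hx : x ∈ (trivializationAt E (TangentSpace I : M → Type _) p).baseSet) (w : E) :
    constField (I := I) p w x
      = (trivializationAt E (TangentSpace I : M → Type _) p).symmL ℝ x w :=
  (Trivialization.symmL_apply _ hx w).symm

theorem coordMap_constField {p x : M}
    (hx : x ∈ (trivializationAt E (TangentSpace I : M → Type _) p).baseSet) (w : E) :
    coordMap p x (constField (I := I) p w x) = w := by
  rw [coordMap_apply hx, constField, Trivialization.apply_mk_symm _ hx]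

theorem constField_coordMap {p x : M}
    (hx : x ∈ (trivializationAt E (TangentSpace I : M → Type _) p).baseSet)
    (v : TangentSpace I x) :
    constField (I := I) p (coordMap p x v) x = v := by
  rw [coordMap_apply hx, constField, Trivialization.symm_apply_apply_mk _ hx]

theorem constField_add {p x : M}
    (hx : x ∈ (trivializationAt E (TangentSpace I : M → Type _) p).baseSet) (v w : E) :
    constField (I := I) p (v + w) x = constField p v x + constField p w x := by
  simp only [constField_eq_symmL hx, map_add]

theorem constField_smul {p x : M}
    (hx : x ∈ (trivializationAt E (TangentSpace I : M → Type _) p).baseSet) (c : ℝ) (w : E) :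
    constField (I := I) p (c • w) x = c • constField p w x := by
  simp only [constField_eq_symmL hx, map_smul]

theorem contMDiffAt_iff_coordMap {n : ℕ∞ω}
    [ContMDiffVectorBundle n E (TangentSpace I : M → Type _) I] {p x : M}
    (hx : x ∈ (trivializationAt E (TangentSpace I : M → Type _) p).baseSet)
    {Y : Π x : M, TangentSpace I x} :
    CMDiffAt n (T% Y) x ↔ CMDiffAt n (fun y ↦ coordMap p y (Y y)) x := by
  rw [(trivializationAt E (TangentSpace I : M → Type _) p).contMDiffAt_section_iff hx]
  refine Filter.EventuallyEq.contMDiffAt_iff ?_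
  filter_upwards [eventually_mem_baseSet hx] with y hy using (coordMap_apply hy _).symm

theorem mdifferentiableAt_iff_coordMap
    [ContMDiffVectorBundle 1 E (TangentSpace I : M → Type _) I] {p x : M}
    (hx : x ∈ (trivializationAt E (TangentSpace I : M → Type _) p).baseSet)
    {Y : Π x : M, TangentSpace I x} :
    MDiffAt (T% Y) x ↔ MDiffAt (fun y ↦ coordMap p y (Y y)) x := by
  rw [(trivializationAt E (TangentSpace I : M → Type _) p).mdifferentiableAt_section_iff I Y hx]
  refine Filter.EventuallyEq.mdifferentiableAt_iff ?_
  filter_upwards [eventually_mem_baseSet hx] with y hy using (coordMap_apply hy _).symm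

theorem contMDiffAt_constField {n : ℕ∞ω}
    [ContMDiffVectorBundle n E (TangentSpace I : M → Type _) I] {p x : M}
    (hx : x ∈ (trivializationAt E (TangentSpace I : M → Type _) p).baseSet) (w : E) :
    CMDiffAt n (T% (constField (I := I) p w)) x := by
  rw [contMDiffAt_iff_coordMap hx]
  refine (contMDiffAt_const (c := w)).congr_of_eventuallyEq ?_
  filter_upwards [eventually_mem_baseSet hx] with y hy using coordMap_constField hy w

theorem mdifferentiableAt_constField
    [ContMDiffVectorBundle 1 E (TangentSpace I : M → Type _) I] {p x : M}
    (hx : x ∈ (trivializationAt E (TangentSpace I : M → Type _) p).baseSet) (w : E) :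
    MDiffAt (T% (constField (I := I) p w)) x :=
  (contMDiffAt_constField (n := 1) hx w).mdifferentiableAt one_ne_zero

variable [FiniteDimensional ℝ E]

omit [IsManifold I 1 M] in
/-- A family of operators depends smoothly on the parameter if its values at all vectors do. -/
theorem contMDiffAt_clm_of_apply {F : Type*} [NormedAddCommGroup F] [NormedSpace ℝ F] {n : ℕ∞ω}
    {f : M → E →L[ℝ] F} {x : M} (h : ∀ w, CMDiffAt n (fun y ↦ f y w) x) : CMDiffAt n f x := by
  let b := Module.finBasis ℝ E
  -- In a basis, `f` is a finite sum of fixed continuous linear maps applied to the smooth functions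
  -- `y ↦ f y (b i)`.
  have hf : f = fun y ↦ ∑ i, ContinuousLinearMap.smulRightL ℝ E F
      (LinearMap.toContinuousLinearMap (b.coord i)) (f y (b i)) := by
    funext y
    ext v
    conv_lhs => rw [← b.sum_repr v, map_sum]
    simp [-Module.Basis.sum_repr]
  rw [hf]
  refine ContMDiffAt.sum fun i _ ↦ ?_
  exact (ContinuousLinearMap.contMDiff _).contMDiffAt.comp x (h (b i))

/-- A field of linear maps on the tangent spaces is smooth if it sends coordinate-constant vector
fields to smooth sections. -/
theorem contMDiffAt_hom_of_apply_constField {n : ℕ∞ω}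
    {F : Type*} [NormedAddCommGroup F] [NormedSpace ℝ F]
    {V : M → Type*} [TopologicalSpace (TotalSpace F V)] [∀ x, AddCommGroup (V x)]
    [∀ x, Module ℝ (V x)] [∀ x, TopologicalSpace (V x)] [∀ x, IsTopologicalAddGroup (V x)]
    [∀ x, ContinuousSMul ℝ (V x)] [FiberBundle F V] [VectorBundle ℝ F V]
    {φ : Π x : M, TangentSpace I x →L[ℝ] V x} {p : M}
    (h : ∀ w, CMDiffAt n (fun x ↦ TotalSpace.mk' F (E := V) x (φ x (constField p w x))) p) :
    ContMDiffAt I (I.prod 𝓘(ℝ, E →L[ℝ] F)) n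
      (fun x ↦ TotalSpace.mk' (E →L[ℝ] F) (E := fun x : M ↦ TangentSpace I x →L[ℝ] V x)
        x (φ x)) p := by
  rw [contMDiffAt_hom_bundle]
  refine ⟨contMDiffAt_id, contMDiffAt_clm_of_apply fun w ↦ ?_⟩
  refine (contMDiffAt_section _ |>.mp (h w)).congr_of_eventuallyEq ?_
  filter_upwards [eventually_mem_baseSet (I := I) (mem_baseSet_self p),
    (trivializationAt F V p).open_baseSet.mem_nhds
      (FiberBundle.mem_baseSet_trivializationAt' p)] with y hy hy'
  rw [constField_eq_symmL hy]
  simp [ContinuousLinearMap.inCoordinates, Trivialization.coe_linearMapAt_of_mem _ hy']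

end Coordinates

section RiemannianBundle

variable {F : Type*} [NormedAddCommGroup F] [NormedSpace ℝ F]
  {V : M → Type*} [TopologicalSpace (TotalSpace F V)] [∀ x, AddCommGroup (V x)]
  [∀ x, Module ℝ (V x)] [∀ x, TopologicalSpace (V x)] [∀ x, IsTopologicalAddGroup (V x)]
  [∀ x, ContinuousConstSMul ℝ (V x)] [FiberBundle F V] [VectorBundle ℝ F V] [RiemannianBundle V]

theorem contMDiffAt_inner {n : ℕ∞ω} [IsContMDiffRiemannianBundle I n F V]
    {Y Z : Π x : M, V x} {x : M}
    (hY : CMDiffAt n (T% Y) x) (hZ : CMDiffAt n (T% Z) x) :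
    CMDiffAt n (fun y ↦ (inner ℝ (Y y) (Z y) : ℝ)) x :=
  hY.inner_bundle hZ

theorem mdifferentiableAt_inner [IsContMDiffRiemannianBundle I 1 F V]
    {Y Z : Π x : M, V x} {x : M}
    (hY : MDiffAt (T% Y) x) (hZ : MDiffAt (T% Z) x) :
    MDiffAt (fun y ↦ (inner ℝ (Y y) (Z y) : ℝ)) x :=
  hY.inner_bundle hZ

end RiemannianBundle

section Metric

variable [FiniteDimensional ℝ E] [RiemannianBundle (fun x : M ↦ TangentSpace I x)]
  [IsManifold I 1 M]

/-- The Riemannian metric in the preferred chart at `p`. -/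
def metricCoord (p x : M) : E →L[ℝ] E →L[ℝ] ℝ :=
  haveI s := (trivializationAt E (TangentSpace I : M → Type _) p).symmL ℝ x
  (ContinuousLinearMap.compL ℝ E (TangentSpace I x) ℝ).flip s ∘L (innerSL ℝ ∘L s)

omit [FiniteDimensional ℝ E] in
theorem metricCoord_apply {p x : M}
    (hx : x ∈ (trivializationAt E (TangentSpace I : M → Type _) p).baseSet) (u w : E) :
    metricCoord (I := I) p x u w = inner ℝ (constField (I := I) p u x) (constField p w x) := by
  simp only [constField_eq_symmL hx]
  rfl

variable {n : ℕ∞ω} [ContMDiffVectorBundle n E (TangentSpace I : M → Type _) I]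
  [IsContMDiffRiemannianBundle I n E (fun x : M ↦ TangentSpace I x)]

theorem contMDiffAt_metricCoord {p x : M}
    (hx : x ∈ (trivializationAt E (TangentSpace I : M → Type _) p).baseSet) :
    CMDiffAt n (metricCoord (I := I) p) x := by
  refine contMDiffAt_clm_of_apply fun u ↦ contMDiffAt_clm_of_apply fun w ↦ ?_
  refine (contMDiffAt_inner (V := fun x : M ↦ TangentSpace I x)
    (contMDiffAt_constField hx u)
    (contMDiffAt_constField hx w)).congr_of_eventuallyEq ?_
  filter_upwards [eventually_mem_baseSet hx] with y hy using metricCoord_apply hy u w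

-- Positive definiteness; in finite dimension this makes the Gram operator an isomorphism onto the
-- dual.
omit [FiniteDimensional ℝ E] in
theorem injective_metricCoord {p x : M}
    (hx : x ∈ (trivializationAt E (TangentSpace I : M → Type _) p).baseSet) :
    Function.Injective (metricCoord (I := I) p x) := by
  rw [injective_iff_map_eq_zero]
  intro u hu
  have h := metricCoord_apply (I := I) hx u u
  rw [hu, zero_apply, eq_comm, inner_self_eq_zero] at h
  rw [← coordMap_constField (I := I) hx u, h, map_zero]

/-- A vector field is smooth if its inner products with the coordinate-constant fields are. -/
theorem contMDiffAt_of_inner_constField {p : M} {Y : Π x : M, TangentSpace I x}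
    (h : ∀ w, CMDiffAt n (fun x ↦ (inner ℝ (Y x) (constField p w x) : ℝ)) p) :
    CMDiffAt n (T% Y) p := by
  rw [contMDiffAt_iff_coordMap (mem_baseSet_self p)]
  have hfin : Module.finrank ℝ E = Module.finrank ℝ (E →L[ℝ] ℝ) := by
    rw [← LinearMap.toContinuousLinearMap (𝕜 := ℝ) (E := E) (F' := ℝ) |>.finrank_eq]
    exact (Subspace.dual_finrank_eq (K := ℝ) (V := E)).symm
  have equiv : ∀ x ∈ (trivializationAt E (TangentSpace I : M → Type _) p).baseSet,
      ∃ e : E ≃L[ℝ] (E →L[ℝ] ℝ), (e : E →L[ℝ] (E →L[ℝ] ℝ)) = metricCoord (I := I) p x :=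
    fun x hx ↦ ⟨(LinearEquiv.ofInjectiveOfFinrankEq (metricCoord (I := I) p x).toLinearMap
      (injective_metricCoord hx) hfin).toContinuousLinearEquiv, by ext; rfl⟩
  let ℓ : M → E →L[ℝ] ℝ := fun x ↦ metricCoord (I := I) p x (coordMap p x (Y x))
  have hℓ : CMDiffAt n ℓ p := by
    refine contMDiffAt_clm_of_apply fun w ↦ (h w).congr_of_eventuallyEq ?_
    filter_upwards [eventually_mem_baseSet (I := I) (mem_baseSet_self p)] with y hy
    rw [metricCoord_apply hy, constField_coordMap hy]
  -- The coordinates of `Y` are recovered from its inner products by the inverse Gram operator, and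
  -- operator inversion is smooth at invertible operators.
  have hinv : CMDiffAt n (fun x ↦ (metricCoord (I := I) p x).inverse) p := by
    obtain ⟨e, he⟩ := equiv p (mem_baseSet_self p)
    have := contDiffAt_map_inverse (n := n) e
    rw [he] at this
    exact this.contMDiffAt.comp p (contMDiffAt_metricCoord (mem_baseSet_self p))
  refine (hinv.clm_apply hℓ).congr_of_eventuallyEq ?_
  filter_upwards [eventually_mem_baseSet (I := I) (mem_baseSet_self p)] with y hy
  obtain ⟨e, he⟩ := equiv y hy
  simp only [ℓ, ← he]
  simp

end Metric

end

/-! ### Covariant derivatives in coordinates -/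

section

variable {E : Type*} [NormedAddCommGroup E] [NormedSpace ℝ E]
  {H : Type*} [TopologicalSpace H] {I : ModelWithCorners ℝ E H}
  {M : Type*} [TopologicalSpace M] [ChartedSpace H M]

section Calculus

theorem mvfderiv_congr {F : Type*} [NormedAddCommGroup F] [NormedSpace ℝ F] {f g : M → F} {x : M}
    (h : f =ᶠ[𝓝 x] g) : mvfderiv I f x = mvfderiv I g x := by
  have h1 : mfderiv I 𝓘(ℝ, F) f x = mfderiv I 𝓘(ℝ, F) g x := h.mfderiv_eq
  exact h1

variable {F G : Type*} [NormedAddCommGroup F] [NormedSpace ℝ F]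
  [NormedAddCommGroup G] [NormedSpace ℝ G]

theorem mvfderiv_clm_apply_const {f : M → F →L[ℝ] G} {x : M} (hf : MDiffAt f x) (w : F)
    (X : TangentSpace I x) :
    mvfderiv I (fun y ↦ f y w) x X = mvfderiv I f x X w := by
  let L : (F →L[ℝ] G) →L[ℝ] G := ContinuousLinearMap.apply ℝ G w
  have h : HasMFDerivAt I 𝓘(ℝ, G) (fun y ↦ f y w) x (L ∘L mvfderiv I f x) :=
    (L.hasMFDerivAt (x := f x)).comp x hf.hasMFDerivAt
  have h' : mvfderiv I (fun y ↦ f y w) x = L ∘L mvfderiv I f x := h.mfderiv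
  rw [h']
  rfl

theorem hasDerivWithinAt_comp_curve {f : M → F} {γ : ℝ → M} {s : Set ℝ} {t : ℝ}
    (hf : MDiffAt f (γ t)) (hγ : MDifferentiableWithinAt 𝓘(ℝ, ℝ) I γ s t) :
    HasDerivWithinAt (fun r ↦ f (γ r)) (mvfderiv I f (γ t) (velocityWithin γ s t)) s t := by
  let D : ℝ →L[ℝ] F := mvfderiv I f (γ t) ∘L mfderivWithin 𝓘(ℝ, ℝ) I γ s t
  have h : HasFDerivWithinAt (fun r ↦ f (γ r)) D s t :=
    (hf.hasMFDerivAt.comp_hasMFDerivWithinAt t hγ.hasMFDerivWithinAt).hasFDerivWithinAt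
  exact h.hasDerivWithinAt

end Calculus

variable [IsManifold I 1 M] [FiniteDimensional ℝ E]
  [ContMDiffVectorBundle 1 E (TangentSpace I : M → Type _) I]

/-- The expression of a covariant derivative in the preferred chart at `p`. -/
theorem cov_eq_coord (cov : CovariantDerivative I E (TangentSpace I : M → Type _)) {p x : M}
    (hx : x ∈ (trivializationAt E (TangentSpace I : M → Type _) p).baseSet)
    {σ : Π x : M, TangentSpace I x} (hσ : MDiffAt (T% σ) x) (X : TangentSpace I x) :
    cov σ x X = constField p (mvfderiv I (fun y ↦ coordMap p y (σ y)) x X) x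
      + cov (constField p (coordMap p x (σ x))) x X := by
  let e := trivializationAt E (TangentSpace I : M → Type _) p
  -- The covariant derivative minus the flat coordinate derivative: the Leibniz terms cancel, so `Φ
  -- σ` depends only on `σ x` and may be computed on the coordinate-constant field through `σ x`,
  -- whose flat derivative vanishes.
  let Φ : (Π x : M, TangentSpace I x) → TangentSpace I x := fun σ ↦
    cov σ x X - e.symmL ℝ x (mvfderiv I (fun y ↦ coordMap p y (σ y)) x X)
  have hΦ : TensorialAt I E Φ x :=
    { smul := by
        intro f σ hf hσ
        have h1 := (mdifferentiableAt_iff_coordMap hx).1 hσ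
        have h2 : mvfderiv I (fun y ↦ coordMap p y ((f • σ) y)) x X
            = f x • mvfderiv I (fun y ↦ coordMap p y (σ y)) x X
              + mvfderiv I f x X • coordMap p x (σ x) := by
          have := congrArg (fun L ↦ L X) (mvfderiv_smul hf h1)
          simp only [Pi.smul_apply', map_smul]
          exact this
        have h3 : e.symmL ℝ x (coordMap p x (σ x)) = σ x := by
          rw [← constField_eq_symmL hx, constField_coordMap hx]
        simp only [Φ, h2, cov.isCovariantDerivativeOn.leibniz hσ hf (Set.mem_univ x), map_add,
          map_smul, h3]
        simp
        module
      add := by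
        intro σ σ' hσ hσ'
        have h1 := (mdifferentiableAt_iff_coordMap hx).1 hσ
        have h1' := (mdifferentiableAt_iff_coordMap hx).1 hσ'
        have h2 : mvfderiv I (fun y ↦ coordMap p y ((σ + σ') y)) x X
            = mvfderiv I (fun y ↦ coordMap p y (σ y)) x X
              + mvfderiv I (fun y ↦ coordMap p y (σ' y)) x X := by
          have := congrArg (fun L ↦ L X) (mvfderiv_add h1 h1')
          simp only [Pi.add_apply, map_add]
          exact this
        simp only [Φ, h2, cov.isCovariantDerivativeOn.add hσ hσ' (Set.mem_univ x), map_add]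
        simp
        module }
  have key := hΦ.pointwise hσ (mdifferentiableAt_constField hx (coordMap p x (σ x)))
    (constField_coordMap hx (σ x)).symm
  have hc : mvfderiv I (fun y ↦ coordMap p y (constField (I := I) p (coordMap p x (σ x)) y)) x = 0 := by
    rw [← mvfderiv_const (I := I) (coordMap p x (σ x)) (x := x)]
    have : (fun y ↦ coordMap p y (constField (I := I) p (coordMap p x (σ x)) y))
        =ᶠ[𝓝 x] fun _ ↦ coordMap p x (σ x) := by
      filter_upwards [eventually_mem_baseSet hx] with y hy using coordMap_constField hy _
    rw [mvfderiv_congr this]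
  simp only [Φ, hc, zero_apply, map_zero, sub_zero] at key
  rw [constField_eq_symmL hx, ← key]
  exact (add_sub_cancel _ _).symm

/-- The change of coordinates from the preferred chart at `p` to the one at `q`, on `T_x M`. -/
def coordChange (p q x : M) : E →L[ℝ] E :=
  coordMap (I := I) q x ∘L (trivializationAt E (TangentSpace I : M → Type _) p).symmL ℝ x

omit [FiniteDimensional ℝ E] [ContMDiffVectorBundle 1 E (TangentSpace I : M → Type _) I] in
theorem coordChange_apply {p q x : M}
    (hx : x ∈ (trivializationAt E (TangentSpace I : M → Type _) p).baseSet) (w : E) :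
    coordChange (I := I) p q x w = coordMap q x (constField (I := I) p w x) := by
  rw [constField_eq_symmL hx]; rfl

theorem mdifferentiableAt_coordChange {p q x : M}
    (hx : x ∈ (trivializationAt E (TangentSpace I : M → Type _) p).baseSet)
    (hx' : x ∈ (trivializationAt E (TangentSpace I : M → Type _) q).baseSet) :
    MDiffAt (coordChange (I := I) p q) x := by
  refine (contMDiffAt_clm_of_apply (n := 1) fun w ↦ ?_).mdifferentiableAt one_ne_zero
  refine ((contMDiffAt_iff_coordMap hx').1
    (contMDiffAt_constField hx w)).congr_of_eventuallyEq ?_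
  filter_upwards [eventually_mem_baseSet hx] with y hy using coordChange_apply hy w

/-- The covariant derivative along a curve can be computed in any preferred chart. -/
theorem covDerivAlong_eq_coord (cov : CovariantDerivative I E (TangentSpace I : M → Type _))
    {γ : ℝ → M} {V : Π t : ℝ, TangentSpace I (γ t)} {s : Set ℝ} {t : ℝ} {p : M} (ht : t ∈ s)
    (hs : UniqueDiffWithinAt ℝ s t)
    (hp : γ t ∈ (trivializationAt E (TangentSpace I : M → Type _) p).baseSet)
    (hγ : MDifferentiableWithinAt 𝓘(ℝ, ℝ) I γ s t)
    (hV : DifferentiableWithinAt ℝ (fun r ↦ coordMap p (γ r) (V r)) s t) :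
    covDerivAlong cov γ V s t
      = constField p (derivWithin (fun r ↦ coordMap p (γ r) (V r)) s t) (γ t)
        + cov (constField p (coordMap p (γ t) (V t))) (γ t) (velocityWithin γ s t) := by
  have hq := mem_baseSet_self (I := I) (γ t)
  have hT := mdifferentiableAt_coordChange hp hq
  have hTγ := hasDerivWithinAt_comp_curve hT hγ
  have hd := hTγ.clm_apply hV.hasDerivWithinAt
  have hev : coordAlong γ V (γ t) =ᶠ[𝓝[s] t]
      fun r ↦ coordChange (I := I) p (γ t) (γ r) (coordMap p (γ r) (V r)) := by
    filter_upwards [hγ.continuousWithinAt (eventually_mem_baseSet hp),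
      hγ.continuousWithinAt (eventually_mem_baseSet hq)] with r hr hr'
    rw [coordChange_apply hr, constField_coordMap hr, coordMap_apply hr']
    rfl
  have hevt := hev.eq_of_nhdsWithin ht
  have hder := (hd.congr_of_eventuallyEq hev hevt).derivWithin hs
  -- The transformation law of the Christoffel term: its inhomogeneous part is the derivative of the
  -- coordinate change, the same extra term that the product rule `hd` produces.
  have hcov := cov_eq_coord cov hq
    (mdifferentiableAt_constField hp (coordMap p (γ t) (V t))) (velocityWithin γ s t)
  have hfun : mvfderiv I (fun y ↦ coordMap (γ t) y
        (constField (I := I) p (coordMap p (γ t) (V t)) y)) (γ t) (velocityWithin γ s t)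
      = mvfderiv I (coordChange (I := I) p (γ t)) (γ t) (velocityWithin γ s t)
          (coordMap p (γ t) (V t)) := by
    rw [← mvfderiv_clm_apply_const hT]
    have : (fun y ↦ coordMap (γ t) y (constField (I := I) p (coordMap p (γ t) (V t)) y))
        =ᶠ[𝓝 (γ t)] fun y ↦ coordChange (I := I) p (γ t) y (coordMap p (γ t) (V t)) := by
      filter_upwards [eventually_mem_baseSet hp] with y hy using (coordChange_apply hy _).symm
    rw [mvfderiv_congr this]
  rw [hfun, constField_coordMap hp] at hcov
  rw [hcov, covDerivAlong, hder, hevt]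
  simp only [coordChange_apply hp, constField_coordMap hp]
  change constField (γ t) _ (γ t) + _ = _
  rw [constField_add hq, constField_coordMap hq]
  abel

omit [FiniteDimensional ℝ E] in
/-- The coordinates of a differentiable vector field along a curve are differentiable. -/
theorem mdifferentiableWithinAt_iff_coordMap
    {γ : ℝ → M} {V : Π t : ℝ, TangentSpace I (γ t)} {s : Set ℝ} {t : ℝ} {p : M} (ht : t ∈ s)
    (hp : γ t ∈ (trivializationAt E (TangentSpace I : M → Type _) p).baseSet) :
    MDifferentiableWithinAt 𝓘(ℝ, ℝ) I.tangent (fun t ↦ (⟨γ t, V t⟩ : TangentBundle I M)) s t ↔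
      MDifferentiableWithinAt 𝓘(ℝ, ℝ) I γ s t ∧
      DifferentiableWithinAt ℝ (fun r ↦ coordMap p (γ r) (V r)) s t := by
  rw [(trivializationAt E (TangentSpace I : M → Type _) p).mdifferentiableWithinAt_totalSpace_iff
    I (fun t ↦ (⟨γ t, V t⟩ : TangentBundle I M)) hp]
  refine and_congr_right fun hγ ↦ ?_
  rw [mdifferentiableWithinAt_iff_differentiableWithinAt]
  have hev : (fun r ↦ coordMap p (γ r) (V r)) =ᶠ[𝓝[s] t] fun r ↦
      (trivializationAt E (TangentSpace I : M → Type _) p ⟨γ r, V r⟩).2 := by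
    filter_upwards [hγ.continuousWithinAt (eventually_mem_baseSet hp)] with r hr
      using coordMap_apply hr _
  exact (hev.differentiableWithinAt_iff (hev.eq_of_nhdsWithin ht)).symm

end

/-! ### Metric connections along curves -/

section

variable {E : Type*} [NormedAddCommGroup E] [NormedSpace ℝ E]
  {H : Type*} [TopologicalSpace H] {I : ModelWithCorners ℝ E H}
  {M : Type*} [TopologicalSpace M] [ChartedSpace H M] [IsManifold I 1 M] [FiniteDimensional ℝ E]
  [RiemannianBundle (fun x : M ↦ TangentSpace I x)]

section Smooth

/-- The inner products of `β♯` with coordinate-constant fields are values of `β`, hence smooth. -/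
theorem contMDiff_sharp {n : ℕ∞ω} [ContMDiffVectorBundle n E (TangentSpace I : M → Type _) I]
    [IsContMDiffRiemannianBundle I n E (fun x : M ↦ TangentSpace I x)]
    {β : Π x : M, TangentSpace I x →L[ℝ] ℝ}
    (hβ : ContMDiff I (I.prod 𝓘(ℝ, E →L[ℝ] ℝ)) n
      (fun x ↦ TotalSpace.mk' (E →L[ℝ] ℝ)
        (E := fun x : M ↦ TangentSpace I x →L[ℝ] Bundle.Trivial M ℝ x) x (β x))) :
    CMDiff n (T% (sharp β)) := by
  intro p
  refine contMDiffAt_of_inner_constField fun w ↦ ?_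
  simp only [inner_sharp]
  have h := (hβ p).clm_bundle_apply (F₁ := E) (E₁ := (TangentSpace I : M → Type _))
    (E₂ := Bundle.Trivial M ℝ) (contMDiffAt_constField (n := n) (mem_baseSet_self p) w)
  rw [contMDiffAt_section] at h
  exact h

end Smooth

section Curves

variable [ContMDiffVectorBundle 1 E (TangentSpace I : M → Type _) I]
  [IsContMDiffRiemannianBundle I 1 E (fun x : M ↦ TangentSpace I x)]
  {cov : CovariantDerivative I E (TangentSpace I : M → Type _)}
  {γ : ℝ → M} {V : Π t : ℝ, TangentSpace I (γ t)} {s : Set ℝ} {t : ℝ}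

/-- Since `V` exists only along the curve, `IsMetric` does not apply to it directly. It is applied
to the field whose coordinates are frozen at those of `V t`; the variation of the coordinates enters
through the product rule. -/
theorem hasDerivWithinAt_inner_section (hcov : IsMetric cov) {σ : Π x : M, TangentSpace I x}
    (ht : t ∈ s) (hs : UniqueDiffWithinAt ℝ s t) (hσ : MDiffAt (T% σ) (γ t))
    (hV : MDifferentiableWithinAt 𝓘(ℝ, ℝ) I.tangent
      (fun t ↦ (⟨γ t, V t⟩ : TangentBundle I M)) s t) :
    HasDerivWithinAt (fun r ↦ (inner ℝ (σ (γ r)) (V r) : ℝ))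
      (inner ℝ (cov σ (γ t) (velocityWithin γ s t)) (V t)
        + inner ℝ (σ (γ t)) (covDerivAlong cov γ V s t)) s t := by
  set p := γ t with hp
  have hb := mem_baseSet_self (I := I) p
  obtain ⟨hγ, hv⟩ := (mdifferentiableWithinAt_iff_coordMap ht hb).1 hV
  let ℓ : M → E →L[ℝ] ℝ := fun x ↦ metricCoord (I := I) p x (coordMap p x (σ x))
  have hℓ : MDiffAt ℓ p :=
    ((contMDiffAt_metricCoord (n := 1) hb).mdifferentiableAt one_ne_zero).clm_apply
      ((mdifferentiableAt_iff_coordMap hb).1 hσ)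
  have hℓ_apply : ∀ y ∈ (trivializationAt E (TangentSpace I : M → Type _) p).baseSet, ∀ w,
      ℓ y w = inner ℝ (σ y) (constField p w y) := by
    intro y hy w
    rw [metricCoord_apply hy, constField_coordMap hy]
  have hd := (hasDerivWithinAt_comp_curve hℓ hγ).clm_apply hv.hasDerivWithinAt
  have hev : (fun r ↦ (inner ℝ (σ (γ r)) (V r) : ℝ)) =ᶠ[𝓝[s] t]
      fun r ↦ ℓ (γ r) (coordMap p (γ r) (V r)) := by
    filter_upwards [hγ.continuousWithinAt (eventually_mem_baseSet hb)] with r hr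
    rw [hℓ_apply _ hr, constField_coordMap hr]
  refine (hd.congr_of_eventuallyEq hev (hev.eq_of_nhdsWithin ht)).congr_deriv ?_
  set v := coordMap p (γ t) (V t) with hv_def
  have h1 : mvfderiv I ℓ p (velocityWithin γ s t) v
      = inner ℝ (cov σ p (velocityWithin γ s t)) (V t)
        + inner ℝ (σ p) (cov (constField p v) p (velocityWithin γ s t)) := by
    rw [← mvfderiv_clm_apply_const hℓ]
    have : (fun y ↦ ℓ y v) =ᶠ[𝓝 p] fun y ↦ (inner ℝ (σ y) (constField p v y) : ℝ) := by
      filter_upwards [eventually_mem_baseSet hb] with y hy using hℓ_apply y hy v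
    rw [mvfderiv_congr this, hcov p _ _ _ hσ (mdifferentiableAt_constField hb v)]
    rw [hv_def, constField_coordMap hb]
  rw [covDerivAlong_eq_coord cov ht hs hb hγ hv, inner_add_right, ← hℓ_apply _ hb, h1]
  ring

/-- Both arguments live only along the curve, so the Gram operator in the chart is differentiated
and its derivative is evaluated on the frozen coordinates of `V t`. -/
theorem hasDerivWithinAt_inner_self (hcov : IsMetric cov)
    (ht : t ∈ s) (hs : UniqueDiffWithinAt ℝ s t)
    (hV : MDifferentiableWithinAt 𝓘(ℝ, ℝ) I.tangent
      (fun t ↦ (⟨γ t, V t⟩ : TangentBundle I M)) s t) :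
    HasDerivWithinAt (fun r ↦ (inner ℝ (V r) (V r) : ℝ))
      (2 * inner ℝ (covDerivAlong cov γ V s t) (V t)) s t := by
  set p := γ t with hp
  have hb := mem_baseSet_self (I := I) p
  obtain ⟨hγ, hv⟩ := (mdifferentiableWithinAt_iff_coordMap ht hb).1 hV
  let g : M → E →L[ℝ] E →L[ℝ] ℝ := metricCoord (I := I) p
  have hg : MDiffAt g p := (contMDiffAt_metricCoord (n := 1) hb).mdifferentiableAt one_ne_zero
  have hd := ((hasDerivWithinAt_comp_curve hg hγ).clm_apply hv.hasDerivWithinAt).clm_apply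
    hv.hasDerivWithinAt
  have hev : (fun r ↦ (inner ℝ (V r) (V r) : ℝ)) =ᶠ[𝓝[s] t]
      fun r ↦ g (γ r) (coordMap p (γ r) (V r)) (coordMap p (γ r) (V r)) := by
    filter_upwards [hγ.continuousWithinAt (eventually_mem_baseSet hb)] with r hr
    rw [metricCoord_apply hr, constField_coordMap hr]
  refine (hd.congr_of_eventuallyEq hev (hev.eq_of_nhdsWithin ht)).congr_deriv ?_
  set v := coordMap p (γ t) (V t) with hv_def
  have h1 : mvfderiv I g p (velocityWithin γ s t) v v
      = 2 * inner ℝ (cov (constField p v) p (velocityWithin γ s t)) (V t) := by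
    have hgv : MDiffAt (fun y ↦ g y v) p := hg.clm_apply mdifferentiableAt_const
    rw [← mvfderiv_clm_apply_const hg, ← mvfderiv_clm_apply_const hgv]
    have : (fun y ↦ g y v v) =ᶠ[𝓝 p]
        fun y ↦ (inner ℝ (constField (I := I) p v y) (constField p v y) : ℝ) := by
      filter_upwards [eventually_mem_baseSet hb] with y hy using metricCoord_apply hy v v
    have hc := mdifferentiableAt_constField (I := I) hb v
    rw [mvfderiv_congr this, hcov p _ _ _ hc hc, hv_def, constField_coordMap hb,
      real_inner_comm]
    ring
  rw [covDerivAlong_eq_coord cov ht hs hb hγ hv, inner_add_left]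
  have hgp : ∀ u w, g p u w = inner ℝ (constField (I := I) p u p) (constField p w p) :=
    metricCoord_apply hb
  change mvfderiv I g p _ v v + g p _ v + g p v _ = 2 * (inner ℝ (constField p _ p) (V t) + _)
  rw [h1, hgp, hgp, hv_def, constField_coordMap hb, real_inner_comm (constField p _ p) (V t)]
  ring

/-- A metric connection for which `β♯` is parallel is compatible with `√α + β`. -/
theorem isCompatible_of_isMetric (hcov : IsMetric cov) {β : Π x : M, TangentSpace I x →L[ℝ] ℝ}
    (hβ : ∀ x, MDiffAt (T% (sharp β)) x) (hpar : ∀ x X, cov (sharp β) x X = 0) :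
    IsCompatible cov (fun x v ↦ √(inner ℝ v v) + β x v) := by
  rintro γ a b hab - v w ⟨V, hV, hV0, rfl, rfl⟩
  have const : ∀ f : ℝ → ℝ, (∀ t ∈ Set.Icc a b, HasDerivWithinAt f 0 (Set.Icc a b) t) →
      f b = f a := fun f hf ↦
    constant_of_derivWithin_zero (fun t ht ↦ (hf t ht).differentiableWithinAt)
      (fun t ht ↦ (hf t (Set.Ico_subset_Icc_self ht)).derivWithin
        (uniqueDiffOn_Icc hab t (Set.Ico_subset_Icc_self ht))) b (Set.right_mem_Icc.2 hab.le)
  -- Along a parallel `V`, both `α(V, V)` and `β(V) = α(β♯, V)` have zero derivative.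
  have h1 := const (fun r ↦ (inner ℝ (V r) (V r) : ℝ)) fun t ht ↦ by
    simpa [hV0 t ht] using
      hasDerivWithinAt_inner_self hcov ht (uniqueDiffOn_Icc hab t ht) (hV t ht)
  have h2 := const (fun r ↦ (inner ℝ (sharp β (γ r)) (V r) : ℝ)) fun t ht ↦ by
    simpa [hV0 t ht, hpar] using hasDerivWithinAt_inner_section hcov ht
      (uniqueDiffOn_Icc hab t ht) (hβ (γ t)) (hV t ht)
  simp only [inner_sharp] at h1 h2
  change √(inner ℝ (V b) (V b)) + _ = √(inner ℝ (V a) (V a)) + _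
  rw [h1, h2]

end Curves

end

/-! ### Parallel transport and compatible connections -/

section

variable {E : Type*} [NormedAddCommGroup E] [NormedSpace ℝ E]

/-- A linear differential equation with small coefficients has solutions on the unit interval. -/
theorem exists_linear_ode_solution [CompleteSpace E] {A : ℝ → E →L[ℝ] E}
    (hA : ContinuousOn A (Set.Icc 0 1)) (hA' : ∀ t ∈ Set.Icc (0 : ℝ) 1, ‖A t‖ ≤ 1 / 2) (v : E) :
    ∃ α : ℝ → E, α 0 = v ∧
      ∀ t ∈ Set.Icc (0 : ℝ) 1, HasDerivWithinAt α (A t (α t)) (Set.Icc 0 1) t := by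
  -- On the ball of radius `‖v‖ + 1` about `v` one has `‖x‖ ≤ 2‖v‖ + 1`, so the speed is at most
  -- `‖v‖ + 1/2`. In unit time the solution cannot leave the ball.
  have h : IsPicardLindelof (fun t x ↦ A t x) (⟨0, by simp⟩ : Set.Icc (0 : ℝ) 1) v
      (‖v‖₊ + 1) 0 (‖v‖₊ + 1) (1 / 2) :=
    { lipschitzOnWith := fun t ht ↦ by
        refine ((A t).lipschitz.weaken ?_).lipschitzOnWith
        rw [← NNReal.coe_le_coe]
        simpa using hA' t ht
      continuousOn := fun x _ ↦ hA.clm_apply continuousOn_const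
      norm_le := fun t ht x hx ↦ by
        have h1 : ‖x‖ ≤ ‖v‖ + (‖v‖ + 1) := by
          have := norm_le_norm_add_norm_sub' x v
          rw [mem_closedBall_iff_norm] at hx
          simp only [NNReal.coe_add, coe_nnnorm, NNReal.coe_one] at hx
          linarith
        have h2 := (A t).le_of_opNorm_le_of_le (hA' t ht) h1
        simp only [NNReal.coe_add, coe_nnnorm, NNReal.coe_one]
        linarith
      mul_max_le := by simp }
  exact h.exists_eq_forall_mem_Icc_hasDerivWithinAt₀

variable {M : Type*} [TopologicalSpace M] [ChartedSpace E M] [FiniteDimensional ℝ E]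

section Christoffel

variable [IsManifold 𝓘(ℝ, E) 1 M]
  [ContMDiffVectorBundle 1 E (TangentSpace 𝓘(ℝ, E) : M → Type _) 𝓘(ℝ, E)]
  (cov : CovariantDerivative 𝓘(ℝ, E) E (TangentSpace 𝓘(ℝ, E) : M → Type _))

/-- Linearity in `w` uses locality of `cov`, because coordinate-constant fields are only known to
add and scale on the base set. Outside it `Γ` is arbitrary. -/
theorem exists_christoffel (p : M) :
    ∃ Γ : M → E →L[ℝ] E →L[ℝ] E,
      ∀ x ∈ (trivializationAt E (TangentSpace 𝓘(ℝ, E) : M → Type _) p).baseSet, ∀ w X,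
        Γ x w X = coordMap p x (cov (constField p w) x (constField p X x)) := by
  suffices ∀ x ∈ (trivializationAt E (TangentSpace 𝓘(ℝ, E) : M → Type _) p).baseSet,
      ∃ Γ : E →L[ℝ] E →L[ℝ] E, ∀ w X,
        Γ w X = coordMap p x (cov (constField p w) x (constField p X x)) by
    choose! Γ hΓ using this
    exact ⟨Γ, hΓ⟩
  intro x hx
  let s := (trivializationAt E (TangentSpace 𝓘(ℝ, E) : M → Type _) p).symmL ℝ x
  have hdiff := mdifferentiableAt_constField (I := 𝓘(ℝ, E)) hx
  have hadd : ∀ v w, cov (constField p (v + w)) x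
      = cov (constField p v) x + cov (constField p w) x := by
    intro v w
    rw [← cov.isCovariantDerivativeOn.add (hdiff v) (hdiff w) (Set.mem_univ x)]
    refine cov.isCovariantDerivativeOn.congr_of_eventuallyEq (hdiff _)
      (mdifferentiableAt_add_section (hdiff v) (hdiff w)) Filter.univ_mem ?_
    filter_upwards [eventually_mem_baseSet hx] with y hy using constField_add hy v w
  have hsmul : ∀ (c : ℝ) w, cov (constField p (c • w)) x = c • cov (constField p w) x := by
    intro c w
    rw [← cov.isCovariantDerivativeOn.smul_const c (hdiff w) (Set.mem_univ x)]
    refine cov.isCovariantDerivativeOn.congr_of_eventuallyEq (hdiff _)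
      (MDifferentiableAt.smul_const_section (hdiff w)) Filter.univ_mem ?_
    filter_upwards [eventually_mem_baseSet hx] with y hy using constField_smul hy c w
  let L : E →ₗ[ℝ] E →L[ℝ] E :=
    { toFun := fun w ↦ coordMap p x ∘L cov (constField p w) x ∘L s
      map_add' := fun v w ↦ by
        rw [hadd, ContinuousLinearMap.add_comp, ContinuousLinearMap.comp_add]
      map_smul' := fun c w ↦ by
        rw [hsmul, ContinuousLinearMap.smul_comp, ContinuousLinearMap.comp_smul]
        rfl }
  refine ⟨LinearMap.toContinuousLinearMap L, fun w X ↦ ?_⟩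
  rw [constField_eq_symmL hx X]
  rfl

end Christoffel

variable [IsManifold 𝓘(ℝ, E) ∞ M] [T2Space M]
  {cov : CovariantDerivative 𝓘(ℝ, E) E (TangentSpace 𝓘(ℝ, E) : M → Type _)}

/-- Smoothness of `cov` is stated for globally smooth fields. A bump function extends the
coordinate-constant field globally without changing it near `p`, and `cov` is local; hence the
conclusion only for `x` near `p`. -/
theorem eventually_contMDiffAt_cov_constField (hcov : cov.ContMDiffCovariantDerivative ∞) (p : M) :
    ∀ᶠ x in 𝓝 p, ∀ w, ContMDiffAt 𝓘(ℝ, E) (𝓘(ℝ, E).prod 𝓘(ℝ, E →L[ℝ] E)) ∞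
      (fun y ↦ TotalSpace.mk' (E →L[ℝ] E)
        (E := fun x : M ↦ TangentSpace 𝓘(ℝ, E) x →L[ℝ] TangentSpace 𝓘(ℝ, E) x)
        y (cov (constField p w) y)) x := by
  obtain ⟨χ⟩ : Nonempty (SmoothBumpFunction 𝓘(ℝ, E) p) := inferInstance
  have hsupp : tsupport χ ⊆ (trivializationAt E (TangentSpace 𝓘(ℝ, E) : M → Type _) p).baseSet := by
    rw [TangentBundle.trivializationAt_baseSet]
    exact χ.tsupport_subset_chartAt_source
  have hσ : ∀ w, CMDiff ∞ (T% ((χ : M → ℝ) • constField (I := 𝓘(ℝ, E)) p w)) := by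
    intro w x
    by_cases hx : x ∈ tsupport χ
    · exact χ.contMDiffAt.smul_section (contMDiffAt_constField (hsupp hx) w)
    · have h0 : CMDiffAt ∞ (T% (0 : Π x : M, TangentSpace 𝓘(ℝ, E) x)) x :=
        (contMDiff_zeroSection ℝ (TangentSpace 𝓘(ℝ, E) : M → Type _)) x
      refine h0.congr_of_eventuallyEq ?_
      filter_upwards [(isClosed_tsupport χ).isOpen_compl.mem_nhds hx] with y hy
      simp [image_eq_zero_of_notMem_tsupport hy]
  filter_upwards [eventually_mem_baseSet (I := 𝓘(ℝ, E)) (mem_baseSet_self p),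
    χ.eventuallyEq_one.eventuallyEq_nhds] with x hx hχ w
  refine ((hcov.contMDiff.contMDiff (hσ w).contMDiffOn).contMDiffAt
    Filter.univ_mem).congr_of_eventuallyEq ?_
  filter_upwards [eventually_mem_baseSet hx, hχ.eventuallyEq_nhds] with y hy hχy
  congr 1
  refine cov.isCovariantDerivativeOn.congr_of_eventuallyEq (mdifferentiableAt_constField hy w)
    ((hσ w y).mdifferentiableAt (by simp)) Filter.univ_mem ?_
  filter_upwards [hχy] with z hz
  simp [hz]

theorem eventually_continuousAt_christoffel (hcov : cov.ContMDiffCovariantDerivative ∞) {p : M}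
    {Γ : M → E →L[ℝ] E →L[ℝ] E}
    (hΓ : ∀ x ∈ (trivializationAt E (TangentSpace 𝓘(ℝ, E) : M → Type _) p).baseSet, ∀ w X,
        Γ x w X = coordMap p x (cov (constField p w) x (constField p X x))) :
    ∀ᶠ x in 𝓝 p, ContinuousAt Γ x := by
  filter_upwards [eventually_mem_baseSet (I := 𝓘(ℝ, E)) (mem_baseSet_self p),
    eventually_contMDiffAt_cov_constField hcov p] with x hx hsm
  refine ContMDiffAt.continuousAt (I := 𝓘(ℝ, E)) (I' := 𝓘(ℝ, E →L[ℝ] E →L[ℝ] E)) (n := ∞)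
    (contMDiffAt_clm_of_apply fun w ↦ contMDiffAt_clm_of_apply fun X ↦ ?_)
  have h := (contMDiffAt_iff_coordMap hx).1
    ((hsm w).clm_bundle_apply (contMDiffAt_constField (n := ∞) hx X))
  refine h.congr_of_eventuallyEq ?_
  filter_upwards [eventually_mem_baseSet hx] with y hy using hΓ y hy w X

/-- The preimage in `M` of a segment in the preferred chart at `p`. -/
def chartSegment (p : M) (a b : E) (t : ℝ) : M :=
  (extChartAt 𝓘(ℝ, E) p).symm (a + t • (b - a))

section Segment

variable {p : M} {a b : E}

omit [FiniteDimensional ℝ E] [T2Space M] in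
theorem contMDiffOn_chartSegment
    (h : ∀ t ∈ Set.Icc (0 : ℝ) 1, a + t • (b - a) ∈ (extChartAt 𝓘(ℝ, E) p).target) :
    ContMDiffOn 𝓘(ℝ, ℝ) 𝓘(ℝ, E) ∞ (chartSegment p a b) (Set.Icc 0 1) := by
  have h1 : ContMDiff 𝓘(ℝ, ℝ) 𝓘(ℝ, E) ∞ fun t : ℝ ↦ a + t • (b - a) := by
    rw [contMDiff_iff_contDiff]
    fun_prop
  exact (contMDiffOn_extChartAt_symm p).comp h1.contMDiffOn h

omit [FiniteDimensional ℝ E] [T2Space M] in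
theorem velocityWithin_chartSegment
    (h : ∀ t ∈ Set.Icc (0 : ℝ) 1, a + t • (b - a) ∈ (extChartAt 𝓘(ℝ, E) p).target)
    {t : ℝ} (ht : t ∈ Set.Icc (0 : ℝ) 1) :
    velocityWithin (I := 𝓘(ℝ, E)) (chartSegment p a b) (Set.Icc 0 1) t
      = constField p (b - a) (chartSegment p a b t) := by
  have hsrc : chartSegment p a b t ∈ (chartAt E p).source := by
    rw [← extChartAt_source 𝓘(ℝ, E)]
    exact (extChartAt 𝓘(ℝ, E) p).map_target (h t ht)
  have hbase : chartSegment p a b t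
      ∈ (trivializationAt E (TangentSpace 𝓘(ℝ, E) : M → Type _) p).baseSet := by
    rwa [TangentBundle.trivializationAt_baseSet]
  have hγ : MDifferentiableWithinAt 𝓘(ℝ, ℝ) 𝓘(ℝ, E) (chartSegment p a b) (Set.Icc 0 1) t :=
    (contMDiffOn_chartSegment h t ht).mdifferentiableWithinAt (by simp)
  have hφ : MDiffAt (extChartAt 𝓘(ℝ, E) p) (chartSegment p a b t) :=
    (contMDiffAt_extChartAt' (n := 1) hsrc).mdifferentiableAt one_ne_zero
  have h1 := hasDerivWithinAt_comp_curve hφ hγ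
  have h2 : HasDerivWithinAt (fun r ↦ extChartAt 𝓘(ℝ, E) p (chartSegment p a b r)) (b - a)
      (Set.Icc 0 1) t := by
    have h3 : HasDerivAt (fun r : ℝ ↦ a + r • (b - a)) (b - a) t := by
      simpa using ((hasDerivAt_id t).smul_const (b - a)).const_add a
    exact h3.hasDerivWithinAt.congr (fun r hr ↦ (extChartAt 𝓘(ℝ, E) p).right_inv (h r hr))
      ((extChartAt 𝓘(ℝ, E) p).right_inv (h t ht))
  -- The chart expression of the curve is differentiated by the chain rule and as an affine map; the
  -- two derivatives agree.
  have h4 := (uniqueDiffOn_Icc zero_lt_one t ht).eq_deriv _ h1 h2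
  rw [← constField_coordMap hbase (velocityWithin (chartSegment p a b) (Set.Icc 0 1) t), ← h4,
    coordMap, TangentBundle.continuousLinearMapAt_trivializationAt hsrc]
  rfl

end Segment

set_option synthInstance.maxHeartbeats 100000 in
/-- Near every point, any two points are joined by a curve along which all vectors have parallel
transports, in a way compatible with taking opposites. -/
theorem exists_nhds_parallelTransport (hcov : cov.ContMDiffCovariantDerivative ∞) (p : M) :
    ∃ U ∈ 𝓝 p, ∀ x ∈ U, ∀ y ∈ U, ∃ γ : ℝ → M, γ 0 = x ∧ γ 1 = y ∧
      ContMDiffOn 𝓘(ℝ, ℝ) 𝓘(ℝ, E) ∞ γ (Set.Icc 0 1) ∧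
      ∀ v : TangentSpace 𝓘(ℝ, E) (γ 0), ∃ w : TangentSpace 𝓘(ℝ, E) (γ 1),
        IsParallelTransport cov γ 0 1 v w ∧ IsParallelTransport cov γ 0 1 (-v) (-w) := by
  have : CompleteSpace E := FiniteDimensional.complete ℝ E
  obtain ⟨Γ, hΓ⟩ := exists_christoffel cov p
  let φ := extChartAt 𝓘(ℝ, E) p
  have hφs : ContinuousAt φ.symm (φ p) := continuousAt_extChartAt_symm p
  have hφp : φ.symm (φ p) = p := extChartAt_to_inv p
  have hev : ∀ᶠ x in 𝓝 p, ContinuousAt Γ x ∧ ‖Γ x‖ < ‖Γ p‖ + 1 := by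
    have hc := eventually_continuousAt_christoffel hcov hΓ
    have hn : ContinuousAt (fun x ↦ ‖Γ x‖) p :=
      ContinuousAt.norm (E := E →L[ℝ] E →L[ℝ] E) hc.self_of_nhds
    exact hc.and (hn.eventually_lt_const (lt_add_one _))
  rw [← hφp] at hev
  have hev' := (hφs.eventually hev).and (extChartAt_target_mem_nhds (I := 𝓘(ℝ, E)) p)
  rw [hφp] at hev'
  set C := ‖Γ p‖ + 1 with hC
  have hCpos : 0 < C := by positivity
  obtain ⟨ε, hε, hball⟩ := Metric.eventually_nhds_iff_ball.1 hev'
  -- The bound `ε` keeps segments in the chart and where `‖Γ‖ < C`. The bound `1 / (4C)` gives `C‖φ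
  -- y - φ x‖ ≤ 1/2`, the smallness required by `exists_linear_ode_solution`.
  let ρ := min ε (1 / (4 * C))
  have hρ : 0 < ρ := by positivity
  refine ⟨φ.source ∩ φ ⁻¹' Metric.ball (φ p) ρ, Filter.inter_mem (extChartAt_source_mem_nhds p)
    ((continuousAt_extChartAt p).preimage_mem_nhds (Metric.ball_mem_nhds _ hρ)), ?_⟩
  rintro x ⟨hxs, hx⟩ y ⟨hys, hy⟩
  have hseg : ∀ t ∈ Set.Icc (0 : ℝ) 1, φ x + t • (φ y - φ x) ∈ Metric.ball (φ p) ε := by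
    intro t ht
    refine Metric.ball_subset_ball (ε₁ := ρ) (min_le_left _ _) ?_
    exact (convex_ball (φ p) ρ).add_smul_sub_mem hx hy ht
  have htar : ∀ t ∈ Set.Icc (0 : ℝ) 1, φ x + t • (φ y - φ x) ∈ φ.target :=
    fun t ht ↦ (hball _ (hseg t ht)).2
  have hnorm : C * ‖φ y - φ x‖ ≤ 1 / 2 := by
    have h1 : dist (φ y) (φ x) ≤ 2 * (1 / (4 * C)) := by
      have h2 : ρ ≤ 1 / (4 * C) := min_le_right _ _
      have h3 := dist_triangle_right (φ y) (φ x) (φ p)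
      have h4 : dist (φ y) (φ p) < ρ := hy
      have h5 : dist (φ x) (φ p) < ρ := hx
      linarith
    rw [dist_eq_norm] at h1
    calc C * ‖φ y - φ x‖ ≤ C * (2 * (1 / (4 * C))) := by gcongr
      _ = 1 / 2 := by field_simp; norm_num
  let γ : ℝ → M := chartSegment p (φ x) (φ y)
  have hγsm := contMDiffOn_chartSegment htar
  have hbase : ∀ t ∈ Set.Icc (0 : ℝ) 1,
      γ t ∈ (trivializationAt E (TangentSpace 𝓘(ℝ, E) : M → Type _) p).baseSet := by
    intro t ht
    rw [TangentBundle.trivializationAt_baseSet, ← extChartAt_source 𝓘(ℝ, E)]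
    exact φ.map_target (htar t ht)
  have h0 : (0 : ℝ) ∈ Set.Icc (0 : ℝ) 1 := by simp
  have h1 : (1 : ℝ) ∈ Set.Icc (0 : ℝ) 1 := by simp
  -- The parallel transport equation in coordinates, where the velocity is the constant `φ y - φ x`.
  let A : ℝ → E →L[ℝ] E := fun t ↦ -(Γ (γ t)).flip (φ y - φ x)
  have hA : ContinuousOn A (Set.Icc 0 1) := by
    have hΓγ : ContinuousOn (fun t ↦ Γ (γ t)) (Set.Icc 0 1) := fun t ht ↦
      ContinuousAt.comp_continuousWithinAt (f := γ) (hball _ (hseg t ht)).1.1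
        (hγsm.continuousOn t ht)
    rw [continuousOn_clm_apply]
    intro w
    exact ((hΓγ.clm_apply continuousOn_const).clm_apply continuousOn_const).neg
  have hA' : ∀ t ∈ Set.Icc (0 : ℝ) 1, ‖A t‖ ≤ 1 / 2 := by
    intro t ht
    refine le_trans ?_ hnorm
    rw [norm_neg]
    refine ((Γ (γ t)).flip.le_opNorm _).trans ?_
    rw [ContinuousLinearMap.opNorm_flip]
    gcongr
    exact (hball _ (hseg t ht)).1.2.le
  have htransport : ∀ α : ℝ → E,
      (∀ t ∈ Set.Icc (0 : ℝ) 1, HasDerivWithinAt α (A t (α t)) (Set.Icc 0 1) t) →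
      IsParallelTransport cov γ 0 1 (constField p (α 0) (γ 0)) (constField p (α 1) (γ 1)) := by
    intro α hα
    have hcoord : ∀ t ∈ Set.Icc (0 : ℝ) 1, HasDerivWithinAt
        (fun r ↦ coordMap p (γ r) (constField p (α r) (γ r))) (A t (α t)) (Set.Icc 0 1) t :=
      fun t ht ↦ (hα t ht).congr (fun r hr ↦ coordMap_constField (hbase r hr) _)
        (coordMap_constField (hbase t ht) _)
    have hγd : ∀ t ∈ Set.Icc (0 : ℝ) 1,
        MDifferentiableWithinAt 𝓘(ℝ, ℝ) 𝓘(ℝ, E) γ (Set.Icc 0 1) t :=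
      fun t ht ↦ (hγsm t ht).mdifferentiableWithinAt (by simp)
    refine ⟨fun t ↦ constField p (α t) (γ t), fun t ht ↦ ?_, fun t ht ↦ ?_, rfl, rfl⟩
    · exact (mdifferentiableWithinAt_iff_coordMap ht (hbase t ht)).2
        ⟨hγd t ht, (hcoord t ht).differentiableWithinAt⟩
    · have hu := uniqueDiffOn_Icc (zero_lt_one' ℝ) t ht
      rw [covDerivAlong_eq_coord cov ht hu (hbase t ht) (hγd t ht)
        (hcoord t ht).differentiableWithinAt, (hcoord t ht).derivWithin hu,
        velocityWithin_chartSegment htar ht, coordMap_constField (hbase t ht)]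
      rw [← constField_coordMap (hbase t ht) (cov (constField p (α t)) (γ t) _),
        ← constField_add (hbase t ht)]
      have : A t (α t) = - coordMap p (γ t) (cov (constField p (α t)) (γ t)
          (constField p (φ y - φ x) (γ t))) := by
        rw [← hΓ (γ t) (hbase t ht)]
        rfl
      rw [this]
      have h00 := constField_smul (I := 𝓘(ℝ, E)) (hbase t ht) 0 0
      rw [zero_smul, zero_smul] at h00
      rw [← h00]
      congr 1
      exact neg_add_cancel _
  refine ⟨γ, ?_, ?_, hγsm, fun v ↦ ?_⟩
  · change φ.symm (φ x + (0 : ℝ) • (φ y - φ x)) = x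
    rw [zero_smul, add_zero, φ.left_inv hxs]
  · change φ.symm (φ x + (1 : ℝ) • (φ y - φ x)) = y
    rw [one_smul, add_sub_cancel, φ.left_inv hys]
  · obtain ⟨α, hα0, hα⟩ := exists_linear_ode_solution hA hA' (coordMap p (γ 0) v)
    have hneg : ∀ t ∈ Set.Icc (0 : ℝ) 1, ∀ w : E,
        constField (I := 𝓘(ℝ, E)) p (-w) (γ t) = -constField p w (γ t) := by
      intro t ht w
      have := constField_smul (I := 𝓘(ℝ, E)) (hbase t ht) (-1) w
      rwa [neg_one_smul, neg_one_smul] at this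
    refine ⟨constField p (α 1) (γ 1), ?_, ?_⟩
    · have := htransport α hα
      rwa [hα0, constField_coordMap (hbase 0 h0)] at this
    -- By linearity `-α` solves the same equation, so the opposite vectors are transported by the
    -- same curve.
    · have := htransport (-α) fun t ht ↦ by simpa using (hα t ht).neg
      rwa [Pi.neg_apply, Pi.neg_apply, hneg 0 h0, hneg 1 h1, hα0, constField_coordMap (hbase 0 h0)] at this

section Riemannian

variable [RiemannianBundle (fun x : M ↦ TangentSpace 𝓘(ℝ, E) x)]

/-- If a smooth linear connection is compatible with `√α + β`, then `β♯` has constant length. -/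
theorem exists_norm_sharp_eq [ConnectedSpace M] (hcov : cov.ContMDiffCovariantDerivative ∞)
    {β : Π x : M, TangentSpace 𝓘(ℝ, E) x →L[ℝ] ℝ}
    (hF : IsCompatible cov (fun x v ↦ √(inner ℝ v v) + β x v)) :
    ∃ K : ℝ, ∀ x, ‖sharp β x‖ = K := by
  have key : ∀ p : M, ∃ U ∈ 𝓝 p, ∀ x ∈ U, ∀ y ∈ U, ‖sharp β x‖ ≤ ‖sharp β y‖ := by
    intro p
    obtain ⟨U, hU, h⟩ := exists_nhds_parallelTransport hcov p
    refine ⟨U, hU, fun x hx y hy ↦ ?_⟩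
    obtain ⟨γ, rfl, rfl, hγ, hpar⟩ := h x hx y hy
    obtain ⟨w, hw, hw'⟩ := hpar (sharp β (γ 0))
    -- Half the sum and half the difference of `F(w)` and `F(-w)` are `‖w‖` and `β(w)`.
    have h1 := hF γ 0 1 zero_lt_one hγ _ _ hw
    have h2 := hF γ 0 1 zero_lt_one hγ _ _ hw'
    simp only [inner_neg_neg, map_neg, real_inner_self_eq_norm_sq,
      Real.sqrt_sq (norm_nonneg _)] at h1 h2
    have h3 : ‖w‖ = ‖sharp β (γ 0)‖ := by linarith
    have h4 : β (γ 1) w = β (γ 0) (sharp β (γ 0)) := by linarith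
    -- Cauchy-Schwarz reads `‖β♯_x‖² ≤ ‖β♯_y‖ ‖β♯_x‖`; division is possible unless `β♯_x = 0`, when
    -- the claim is trivial.
    have h5 := real_inner_le_norm (sharp β (γ 1)) w
    rw [inner_sharp, h4, ← inner_sharp, real_inner_self_eq_norm_sq, h3] at h5
    by_cases h0 : ‖sharp β (γ 0)‖ = 0
    · rw [h0]; exact norm_nonneg _
    · have h6 : 0 < ‖sharp β (γ 0)‖ := lt_of_le_of_ne (norm_nonneg _) (Ne.symm h0)
      nlinarith
  have hlc : IsLocallyConstant fun x ↦ ‖sharp β x‖ := by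
    refine (IsLocallyConstant.iff_eventually_eq _).2 fun p ↦ ?_
    obtain ⟨U, hU, h⟩ := key p
    filter_upwards [hU] with y hy
    exact le_antisymm (h y hy p (mem_of_mem_nhds hU)) (h p (mem_of_mem_nhds hU) y hy)
  obtain ⟨p⟩ : Nonempty M := inferInstance
  exact ⟨‖sharp β p‖, fun x ↦ hlc.apply_eq_of_isPreconnected isPreconnected_univ
    (Set.mem_univ x) (Set.mem_univ p)⟩

end Riemannian

end

/-! ### The Levi-Civita connection -/

section

open VectorField

variable {E : Type*} [NormedAddCommGroup E] [NormedSpace ℝ E] [FiniteDimensional ℝ E]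
  {H : Type*} [TopologicalSpace H] {I : ModelWithCorners ℝ E H}
  {M : Type*} [TopologicalSpace M] [ChartedSpace H M]

section Smooth

variable [IsManifold I 1 M]

omit [FiniteDimensional ℝ E] in
theorem contMDiffAt_mvfderiv_apply {f : M → ℝ} {X : Π x : M, TangentSpace I x} {p : M}
    (hf : CMDiffAt ∞ f p) (hX : CMDiffAt ∞ (T% X) p) :
    CMDiffAt ∞ (fun x ↦ mvfderiv I f x (X x)) p := by
  have h := ContMDiffAt.clm_apply_of_inCoordinates (b₁ := fun x : M ↦ x) (b₂ := f) (F₁ := E)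
    (F₂ := ℝ) (E₁ := (TangentSpace I : M → Type _)) (E₂ := (TangentSpace 𝓘(ℝ, ℝ) : ℝ → Type _))
    (hf.mfderiv_const (m := ∞) le_rfl) hX hf
  exact (contMDiff_snd_tangentBundle_modelSpace ℝ 𝓘(ℝ, ℝ) (n := ∞)).contMDiffAt.comp p h

end Smooth

variable [RiemannianBundle (fun x : M ↦ TangentSpace I x)] [IsManifold I 2 M]

/-- The right-hand side of the Koszul formula for `α(∇_X σ, Z)`. -/
def koszul (σ X Z : Π x : M, TangentSpace I x) (x : M) : ℝ :=
  (mvfderiv I (fun y ↦ (inner ℝ (σ y) (Z y) : ℝ)) x (X x)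
    + mvfderiv I (fun y ↦ (inner ℝ (X y) (Z y) : ℝ)) x (σ x)
    - mvfderiv I (fun y ↦ (inner ℝ (X y) (σ y) : ℝ)) x (Z x)
    + inner ℝ (mlieBracket I X σ x) (Z x)
    - inner ℝ (mlieBracket I X Z x) (σ x)
    - inner ℝ (mlieBracket I σ Z x) (X x)) / 2

section Koszul

variable [IsContMDiffRiemannianBundle I 1 E (fun x : M ↦ TangentSpace I x)] {x : M}

omit [FiniteDimensional ℝ E] in
theorem mvfderiv_inner_add_left {X X' Z : Π x : M, TangentSpace I x}
    (hX : MDiffAt (T% X) x) (hX' : MDiffAt (T% X') x) (hZ : MDiffAt (T% Z) x)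
    (v : TangentSpace I x) :
    mvfderiv I (fun y ↦ (inner ℝ ((X + X') y) (Z y) : ℝ)) x v
      = mvfderiv I (fun y ↦ (inner ℝ (X y) (Z y) : ℝ)) x v
        + mvfderiv I (fun y ↦ (inner ℝ (X' y) (Z y) : ℝ)) x v := by
  have h := mvfderiv_add
    (mdifferentiableAt_inner (V := fun x : M ↦ TangentSpace I x) hX hZ)
    (mdifferentiableAt_inner (V := fun x : M ↦ TangentSpace I x) hX' hZ)
  simp only [Pi.add_apply, inner_add_left]
  exact congrArg (fun L ↦ L v) h

omit [FiniteDimensional ℝ E] in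
theorem mvfderiv_inner_smul_left {f : M → ℝ} {X Z : Π x : M, TangentSpace I x}
    (hf : MDiffAt f x) (hX : MDiffAt (T% X) x) (hZ : MDiffAt (T% Z) x)
    (v : TangentSpace I x) :
    mvfderiv I (fun y ↦ (inner ℝ ((f • X) y) (Z y) : ℝ)) x v
      = f x * mvfderiv I (fun y ↦ (inner ℝ (X y) (Z y) : ℝ)) x v
        + mvfderiv I f x v * inner ℝ (X x) (Z x) := by
  have h := mvfderiv_smul hf (mdifferentiableAt_inner (V := fun x : M ↦ TangentSpace I x) hX hZ)
  simp only [Pi.smul_apply', real_inner_smul_left]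
  exact congrArg (fun L ↦ L v) h

omit [FiniteDimensional ℝ E] in
theorem mvfderiv_inner_add_right {X X' Z : Π x : M, TangentSpace I x}
    (hX : MDiffAt (T% X) x) (hX' : MDiffAt (T% X') x) (hZ : MDiffAt (T% Z) x)
    (v : TangentSpace I x) :
    mvfderiv I (fun y ↦ (inner ℝ (Z y) ((X + X') y) : ℝ)) x v
      = mvfderiv I (fun y ↦ (inner ℝ (Z y) (X y) : ℝ)) x v
        + mvfderiv I (fun y ↦ (inner ℝ (Z y) (X' y) : ℝ)) x v := by
  simp only [real_inner_comm _ (Z _)]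
  exact mvfderiv_inner_add_left hX hX' hZ v

omit [FiniteDimensional ℝ E] in
theorem mvfderiv_inner_smul_right {f : M → ℝ} {X Z : Π x : M, TangentSpace I x}
    (hf : MDiffAt f x) (hX : MDiffAt (T% X) x) (hZ : MDiffAt (T% Z) x)
    (v : TangentSpace I x) :
    mvfderiv I (fun y ↦ (inner ℝ (Z y) ((f • X) y) : ℝ)) x v
      = f x * mvfderiv I (fun y ↦ (inner ℝ (Z y) (X y) : ℝ)) x v
        + mvfderiv I f x v * inner ℝ (Z x) (X x) := by
  simp only [real_inner_comm _ (Z _)]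
  exact mvfderiv_inner_smul_left hf hX hZ v

variable {σ σ' X Z : Π x : M, TangentSpace I x}

/-- The derivatives of `f` coming from the inner products cancel those coming from the brackets. -/
theorem tensorialAt_koszul₁ (hσ : MDiffAt (T% σ) x) (hZ : MDiffAt (T% Z) x) :
    TensorialAt I E (koszul σ · Z x) x where
  smul {f X} hf hX := by
    simp only [koszul]
    rw [mvfderiv_inner_smul_left hf hX hZ, mvfderiv_inner_smul_left hf hX hσ,
      mlieBracket_smul_left hf hX, mlieBracket_smul_left hf hX]
    simp only [Pi.smul_apply', map_smul, inner_add_left, real_inner_smul_left,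
      real_inner_smul_right, smul_eq_mul]
    ring
  add {X X'} hX hX' := by
    simp only [koszul]
    rw [mvfderiv_inner_add_left hX hX' hZ, mvfderiv_inner_add_left hX hX' hσ,
      mlieBracket_add_left hX hX', mlieBracket_add_left hX hX']
    simp only [Pi.add_apply, map_add, inner_add_left, inner_add_right]
    ring

theorem tensorialAt_koszul₂ (hσ : MDiffAt (T% σ) x) (hX : MDiffAt (T% X) x) :
    TensorialAt I E (koszul σ X · x) x where
  smul {f Z} hf hZ := by
    simp only [koszul]
    rw [mvfderiv_inner_smul_right hf hZ hσ, mvfderiv_inner_smul_right hf hZ hX,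
      mlieBracket_smul_right hf hZ, mlieBracket_smul_right hf hZ]
    simp only [Pi.smul_apply', map_smul, inner_add_left, real_inner_smul_left,
      real_inner_smul_right, smul_eq_mul, real_inner_comm (σ x) (Z x),
      real_inner_comm (X x) (Z x)]
    ring
  add {Z Z'} hZ hZ' := by
    simp only [koszul]
    rw [mvfderiv_inner_add_right hZ hZ' hσ, mvfderiv_inner_add_right hZ hZ' hX,
      mlieBracket_add_right hZ hZ', mlieBracket_add_right hZ hZ']
    simp only [Pi.add_apply, map_add, inner_add_left, inner_add_right]
    ring

theorem koszul_add (hσ : MDiffAt (T% σ) x) (hσ' : MDiffAt (T% σ') x) (hX : MDiffAt (T% X) x)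
    (hZ : MDiffAt (T% Z) x) : koszul (σ + σ') X Z x = koszul σ X Z x + koszul σ' X Z x := by
  simp only [koszul]
  rw [mvfderiv_inner_add_right hσ hσ' hX, mvfderiv_inner_add_left hσ hσ' hZ,
    mlieBracket_add_right hσ hσ', mlieBracket_add_left hσ hσ']
  simp only [Pi.add_apply, map_add, inner_add_left, inner_add_right]
  ring

/-- In the differentiated slot the `Z f` terms cancel but the two `X f` terms add up, which gives
the Leibniz rule. -/
theorem koszul_smul {f : M → ℝ} (hf : MDiffAt f x) (hσ : MDiffAt (T% σ) x)
    (hX : MDiffAt (T% X) x) (hZ : MDiffAt (T% Z) x) :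
    koszul (f • σ) X Z x = f x * koszul σ X Z x + mvfderiv I f x (X x) * inner ℝ (σ x) (Z x) := by
  simp only [koszul]
  rw [mvfderiv_inner_smul_right hf hσ hX, mvfderiv_inner_smul_left hf hσ hZ,
    mlieBracket_smul_right hf hσ, mlieBracket_smul_left hf hσ]
  simp only [Pi.smul_apply', map_smul, inner_add_left, real_inner_smul_left,
    real_inner_smul_right, smul_eq_mul, real_inner_comm (X x) (σ x)]
  ring

-- This symmetry is metricity of the Koszul connection; all terms antisymmetric in `σ` and `Z` drop
-- out.
omit [FiniteDimensional ℝ E] [IsManifold I 2 M]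
  [IsContMDiffRiemannianBundle I 1 E (fun x : M ↦ TangentSpace I x)] in
theorem koszul_add_koszul_swap (σ X Z : Π x : M, TangentSpace I x) (x : M) :
    koszul σ X Z x + koszul Z X σ x
      = mvfderiv I (fun y ↦ (inner ℝ (σ y) (Z y) : ℝ)) x (X x) := by
  have h : (fun y ↦ (inner ℝ (Z y) (σ y) : ℝ)) = fun y ↦ (inner ℝ (σ y) (Z y) : ℝ) :=
    funext fun y ↦ real_inner_comm _ _
  simp only [koszul, h, mlieBracket_swap_apply (V := Z) (W := σ), inner_neg_left]
  ring

-- This symmetry is torsion-freeness of the Koszul connection.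
omit [FiniteDimensional ℝ E] [IsManifold I 2 M]
  [IsContMDiffRiemannianBundle I 1 E (fun x : M ↦ TangentSpace I x)] in
theorem koszul_sub_koszul_swap (σ X Z : Π x : M, TangentSpace I x) (x : M) :
    koszul σ X Z x - koszul X σ Z x = inner ℝ (mlieBracket I X σ x) (Z x) := by
  have h : (fun y ↦ (inner ℝ (X y) (σ y) : ℝ)) = fun y ↦ (inner ℝ (σ y) (X y) : ℝ) :=
    funext fun y ↦ real_inner_comm _ _
  simp only [koszul, h, mlieBracket_swap_apply (V := σ) (W := X), inner_neg_left]
  ring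


/-- Tensoriality in `X` and `Z` turns the Koszul expression into a bilinear form on `T_x M`, which
the Riesz isomorphism represents by an operator. -/
theorem exists_inner_eq_koszul (hσ : MDiffAt (T% σ) x) :
    ∃ L : TangentSpace I x →L[ℝ] TangentSpace I x, ∀ X Z : Π x : M, TangentSpace I x,
      MDiffAt (T% X) x → MDiffAt (T% Z) x → inner ℝ (L (X x)) (Z x) = koszul σ X Z x := by
  have : CompleteSpace (TangentSpace I x) := FiniteDimensional.complete ℝ _
  let B := TensorialAt.mkHom₂ (koszul σ · · x) x (fun _ hZ ↦ tensorialAt_koszul₁ hσ hZ)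
    (fun _ hX ↦ tensorialAt_koszul₂ hσ hX)
  let L : TangentSpace I x →ₗ[ℝ] TangentSpace I x :=
    { toFun := fun v ↦ (InnerProductSpace.toDual ℝ (TangentSpace I x)).symm (B v)
      map_add' := fun v w ↦ by rw [map_add, map_add]
      map_smul' := fun c v ↦ by rw [map_smul, map_smulₛₗ]; rfl }
  refine ⟨LinearMap.toContinuousLinearMap L, fun X Z hX hZ ↦ ?_⟩
  exact InnerProductSpace.toDual_symm_apply.trans (TensorialAt.mkHom₂_apply _ _ hX hZ)

open Classical in
/-- The operator `∇σ` determined by the Koszul formula. -/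
def koszulMap (σ : Π x : M, TangentSpace I x) (x : M) : TangentSpace I x →L[ℝ] TangentSpace I x :=
  -- The default `0` is harmless: the axioms of a covariant derivative only concern fields
  -- differentiable at `x`.
  if h : MDiffAt (T% σ) x then (exists_inner_eq_koszul h).choose else 0

theorem inner_koszulMap (hσ : MDiffAt (T% σ) x) (hX : MDiffAt (T% X) x)
    (hZ : MDiffAt (T% Z) x) : inner ℝ (koszulMap σ x (X x)) (Z x) = koszul σ X Z x := by
  rw [koszulMap, dif_pos hσ]
  exact (exists_inner_eq_koszul hσ).choose_spec X Z hX hZ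

omit [FiniteDimensional ℝ E] [RiemannianBundle (fun x : M ↦ TangentSpace I x)]
  [IsContMDiffRiemannianBundle I 1 E (fun x : M ↦ TangentSpace I x)] in
theorem exists_mdifferentiableAt_eq (v : TangentSpace I x) :
    ∃ X : Π x : M, TangentSpace I x, MDiffAt (T% X) x ∧ X x = v :=
  ⟨FiberBundle.extend E v, FiberBundle.mdifferentiableAt_extend .., by simp⟩

/-- The Levi-Civita connection defined by the Koszul formula. -/
def leviCivita : CovariantDerivative I E (TangentSpace I : M → Type _) where
  toFun := koszulMap
  isCovariantDerivativeOnUniv :=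
    { add := fun {σ σ' x} hσ hσ' _ ↦ by
        ext v
        obtain ⟨X, hX, rfl⟩ := exists_mdifferentiableAt_eq (I := I) v
        refine ext_inner_right ℝ fun w ↦ ?_
        obtain ⟨Z, hZ, rfl⟩ := exists_mdifferentiableAt_eq (I := I) w
        rw [add_apply, inner_add_left, inner_koszulMap hσ hX hZ, inner_koszulMap hσ' hX hZ,
          inner_koszulMap (mdifferentiableAt_add_section hσ hσ') hX hZ, koszul_add hσ hσ' hX hZ]
      leibniz := fun {σ f x} hσ hf _ ↦ by
        ext v
        obtain ⟨X, hX, rfl⟩ := exists_mdifferentiableAt_eq (I := I) v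
        refine ext_inner_right ℝ fun w ↦ ?_
        obtain ⟨Z, hZ, rfl⟩ := exists_mdifferentiableAt_eq (I := I) w
        rw [inner_koszulMap (hf.smul_section hσ) hX hZ, koszul_smul hf hσ hX hZ,
          ← inner_koszulMap hσ hX hZ, add_apply, inner_add_left, smul_apply,
          real_inner_smul_left, ContinuousLinearMap.smulRight_apply, real_inner_smul_left] }

theorem isMetric_leviCivita : IsMetric (leviCivita (I := I) (M := M)) := by
  intro x v Y Z hY hZ
  obtain ⟨X, hX, rfl⟩ := exists_mdifferentiableAt_eq (I := I) v
  rw [real_inner_comm _ (Y x)]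
  refine Eq.trans ?_ (congrArg₂ _ (inner_koszulMap hY hX hZ) (inner_koszulMap hZ hX hY)).symm
  exact (koszul_add_koszul_swap Y X Z x).symm

theorem torsion_leviCivita : (leviCivita (I := I) (M := M)).torsion = 0 := by
  rw [CovariantDerivative.torsion_eq_zero_iff]
  intro X Y x hX hY
  refine ext_inner_right ℝ fun w ↦ ?_
  obtain ⟨Z, hZ, rfl⟩ := exists_mdifferentiableAt_eq (I := I) w
  rw [inner_sub_left]
  refine Eq.trans ?_ (koszul_sub_koszul_swap Y X Z x)
  exact congrArg₂ _ (inner_koszulMap hY hX hZ) (inner_koszulMap hX hY hZ)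

end Koszul

variable [IsManifold I ∞ M] [ContMDiffVectorBundle ∞ E (TangentSpace I : M → Type _) I]
  [IsContMDiffRiemannianBundle I ∞ E (fun x : M ↦ TangentSpace I x)]

omit [ContMDiffVectorBundle ∞ E (TangentSpace I : M → Type _) I] in
theorem contMDiffAt_koszul {σ X Z : Π x : M, TangentSpace I x} {p : M}
    (hσ : CMDiffAt ∞ (T% σ) p) (hX : CMDiffAt ∞ (T% X) p) (hZ : CMDiffAt ∞ (T% Z) p) :
    CMDiffAt ∞ (koszul σ X Z) p := by
  have inner_smooth {U V : Π x : M, TangentSpace I x} (hU : CMDiffAt ∞ (T% U) p)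
      (hV : CMDiffAt ∞ (T% V) p) : CMDiffAt ∞ (fun x ↦ (inner ℝ (U x) (V x) : ℝ)) p :=
    contMDiffAt_inner (V := fun x : M ↦ TangentSpace I x) hU hV
  have : IsManifold I ((⊤ : ℕ∞) + 1) M := inferInstanceAs (IsManifold I ∞ M)
  have : IsManifold I (minSmoothness ℝ 2) M := by simpa using inferInstanceAs (IsManifold I 2 M)
  have bracket_smooth {U V : Π x : M, TangentSpace I x} (hU : CMDiffAt ∞ (T% U) p)
      (hV : CMDiffAt ∞ (T% V) p) : CMDiffAt ∞ (T% (mlieBracket I U V)) p :=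
    ContMDiffAt.mlieBracket_vectorField (m := ⊤) (n := ⊤) hU hV (by simp)
  unfold koszul
  simp only [div_eq_mul_inv]
  exact (((((contMDiffAt_mvfderiv_apply (inner_smooth hσ hZ) hX).add
    (contMDiffAt_mvfderiv_apply (inner_smooth hX hZ) hσ)).sub
    (contMDiffAt_mvfderiv_apply (inner_smooth hX hσ) hZ)).add
    (inner_smooth (bracket_smooth hX hσ) hZ)).sub
    (inner_smooth (bracket_smooth hX hZ) hσ)).sub
    (inner_smooth (bracket_smooth hσ hZ) hX) |>.mul contMDiffAt_const

/-- Tested against coordinate-constant fields in both remaining slots, `∇σ` becomes a Koszul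
expression in smooth fields. -/
theorem contMDiffCovariantDerivative_leviCivita
    [IsContMDiffRiemannianBundle I 1 E (fun x : M ↦ TangentSpace I x)] :
    (leviCivita (I := I) (M := M)).ContMDiffCovariantDerivative ∞ := by
  refine ⟨⟨fun {σ} hσ ↦ ?_⟩⟩
  rw [contMDiffOn_univ] at hσ ⊢
  intro p
  refine contMDiffAt_hom_of_apply_constField fun w ↦ contMDiffAt_of_inner_constField fun w' ↦ ?_
  refine (contMDiffAt_koszul (hσ p) (contMDiffAt_constField (I := I) (mem_baseSet_self p) w)
    (contMDiffAt_constField (I := I) (mem_baseSet_self p) w')).congr_of_eventuallyEq ?_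
  filter_upwards [eventually_mem_baseSet (I := I) (mem_baseSet_self p)] with x hx
  exact inner_koszulMap ((hσ x).mdifferentiableAt (by simp))
    (mdifferentiableAt_constField (I := I) hx w) (mdifferentiableAt_constField (I := I) hx w')

theorem isLeviCivita_leviCivita
    [IsContMDiffRiemannianBundle I 1 E (fun x : M ↦ TangentSpace I x)] :
    IsLeviCivita (leviCivita (I := I) (M := M)) :=
  ⟨contMDiffCovariantDerivative_leviCivita, isMetric_leviCivita, torsion_leviCivita⟩

end

/-! ### The correction term -/

section

section LinearAlgebra

variable {W : Type*} [NormedAddCommGroup W] [InnerProductSpace ℝ W]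

/-- The bilinear map `(X, Y) ↦ (⟨D X, Y⟩ b - ⟨Y, b⟩ D X) / K²`. -/
def skewCorrection (K : ℝ) (b : W) (D : W →L[ℝ] W) : W →L[ℝ] W →L[ℝ] W :=
  let ι : W →L[ℝ] W →L[ℝ] ℝ := innerSL ℝ
  (K ^ 2)⁻¹ • (((ContinuousLinearMap.smulRightL ℝ W W).flip b).comp (ι.comp D)
    - (ContinuousLinearMap.smulRightL ℝ W W (ι b)).comp D)

theorem skewCorrection_apply (K : ℝ) (b : W) (D : W →L[ℝ] W) (X Y : W) :
    skewCorrection K b D X Y = (inner ℝ (D X) Y / K ^ 2) • b - (inner ℝ Y b / K ^ 2) • D X := by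
  simp only [skewCorrection, smul_apply, sub_apply,
    ContinuousLinearMap.comp_apply, ContinuousLinearMap.flip_apply,
    ContinuousLinearMap.smulRightL_apply_apply,
    ContinuousLinearMap.smulRight_apply, smul_sub, smul_smul,
    real_inner_comm b Y, div_eq_inv_mul]
  rfl

/-- The map is a multiple of the wedge of `D X` and `b`, so it is skew for every `K`. -/
theorem inner_skewCorrection (K : ℝ) (b : W) (D : W →L[ℝ] W) (X Y Z : W) :
    inner ℝ (skewCorrection K b D X Y) Z = -inner ℝ (skewCorrection K b D X Z) Y := by
  simp only [skewCorrection_apply, inner_sub_left, real_inner_smul_left, real_inner_comm b]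
  ring

theorem skewCorrection_apply_self {K : ℝ} (hK : K ≠ 0) {b : W} (hb : ‖b‖ = K) {D : W →L[ℝ] W}
    {X : W} (hD : inner ℝ (D X) b = 0) : skewCorrection K b D X b = -D X := by
  rw [skewCorrection_apply, hD, real_inner_self_eq_norm_sq, hb, div_self (pow_ne_zero 2 hK)]
  simp

/-- Pythagoras: the difference `N` is skew, kills `b` and is orthogonal to the correction, so it
adds `|N|² > 0`. -/
theorem sum_sq_norm_lt_of_skew {ι : Type*} [Fintype ι] (e : OrthonormalBasis ι ℝ W) {K : ℝ}
    {b : W} {D : W →L[ℝ] W} {X : W} {L : W →L[ℝ] W}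
    (hL : ∀ Y Z, inner ℝ (L Y) Z = -inner ℝ (L Z) Y)
    (hLb : L b = skewCorrection K b D X b) (hne : L ≠ skewCorrection K b D X) :
    ∑ j, ‖skewCorrection K b D X (e j)‖ ^ 2 < ∑ j, ‖L (e j)‖ ^ 2 := by
  set N : W →L[ℝ] W := L - skewCorrection K b D X with hN
  have hLN (Y : W) : L Y = skewCorrection K b D X Y + N Y := by simp [hN]
  have hNb : N b = 0 := by simp [hN, hLb]
  have hNskew (Y Z : W) : inner ℝ (N Y) Z = -inner ℝ (N Z) Y := by
    simp only [hN, sub_apply, inner_sub_left, hL Y Z,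
      inner_skewCorrection K b D X Y Z]
    ring
  have horth : ∑ j, inner ℝ (skewCorrection K b D X (e j)) (N (e j)) = 0 := by
    -- The part along `b` drops out since `⟨b, N e_j⟩ = -⟨N b, e_j⟩ = 0`. By Parseval the rest sums
    -- to a multiple of `⟨N (D X), b⟩ = -⟨N b, D X⟩ = 0`.
    have h (j : ι) : inner ℝ (skewCorrection K b D X (e j)) (N (e j))
        = (K ^ 2)⁻¹ * (inner ℝ (N (D X)) (e j) * inner ℝ (e j) b) := by
      rw [skewCorrection_apply, inner_sub_left, real_inner_smul_left, real_inner_smul_left,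
        real_inner_comm (N (e j)) b, hNskew (e j) b, hNb, inner_zero_left,
        real_inner_comm (N (e j)) (D X), hNskew (e j) (D X)]
      ring
    simp only [h, ← Finset.mul_sum]
    rw [e.sum_inner_mul_inner, hNskew, hNb]
    simp
  obtain ⟨j, hj⟩ : ∃ j, N (e j) ≠ 0 := by
    by_contra! h
    refine hne (sub_eq_zero.1 (ContinuousLinearMap.coe_injective (e.toBasis.ext fun j ↦ ?_)))
    rw [OrthonormalBasis.coe_toBasis]
    exact h j
  have hpos : 0 < ∑ j, ‖N (e j)‖ ^ 2 :=
    Finset.sum_pos' (fun _ _ ↦ by positivity) ⟨j, Finset.mem_univ j, by positivity⟩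
  simp only [hLN, norm_add_sq_real, Finset.sum_add_distrib, ← Finset.mul_sum, horth]
  linarith

end LinearAlgebra

variable {E : Type*} [NormedAddCommGroup E] [NormedSpace ℝ E] [FiniteDimensional ℝ E]
  {H : Type*} [TopologicalSpace H] {I : ModelWithCorners ℝ E H}
  {M : Type*} [TopologicalSpace M] [ChartedSpace H M]
  [RiemannianBundle (fun x : M ↦ TangentSpace I x)]

theorem tensorNormSq_eq_sum_sq_norm {x : M} (L : TangentSpace I x →L[ℝ] TangentSpace I x) :
    tensorNormSq L = ∑ j, ‖L (stdOrthonormalBasis ℝ (TangentSpace I x) j)‖ ^ 2 := by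
  rw [tensorNormSq, Finset.sum_comm]
  refine Finset.sum_congr rfl fun j _ ↦ ?_
  simpa using (stdOrthonormalBasis ℝ (TangentSpace I x)).sum_sq_norm_inner_right (L _)

variable [IsManifold I 1 M] {cov : CovariantDerivative I E (TangentSpace I : M → Type _)}
  {β : Π x : M, TangentSpace I x →L[ℝ] ℝ} {K : ℝ}

variable (cov β K) in
/-- The tensor field
`(X, Y) ↦ (α(∇_X β♯, Y) β♯ - α(Y, β♯) ∇_X β♯) / K²`. -/
def correction (x : M) : TangentSpace I x →L[ℝ] TangentSpace I x →L[ℝ] TangentSpace I x :=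
  skewCorrection K (sharp β x) (cov (sharp β) x)

theorem correction_apply (x : M) (X Y : TangentSpace I x) :
    correction cov β K x X Y = (inner ℝ (cov (sharp β) x X) Y / K ^ 2) • sharp β x
      - (inner ℝ Y (sharp β x) / K ^ 2) • cov (sharp β) x X :=
  skewCorrection_apply ..

/-- Differentiate the constant function `α(β♯, β♯) = K²`. -/
theorem inner_cov_sharp_eq_zero (hcov : IsMetric cov) (hβ : ∀ x, MDiffAt (T% (sharp β)) x)
    (hK : ∀ x, ‖sharp β x‖ = K) (x : M) (X : TangentSpace I x) :
    inner ℝ (cov (sharp β) x X) (sharp β x) = 0 := by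
  have h := hcov x X _ _ (hβ x) (hβ x)
  have hc : (fun y ↦ (inner ℝ (sharp β y) (sharp β y) : ℝ)) = fun _ ↦ K ^ 2 :=
    funext fun y ↦ by rw [real_inner_self_eq_norm_sq, hK]
  rw [hc, mvfderiv_const, real_inner_comm _ (sharp β x)] at h
  have h0 : (0 : ℝ) = inner ℝ (cov (sharp β) x X) (sharp β x)
      + inner ℝ (cov (sharp β) x X) (sharp β x) := h
  linarith

theorem correction_apply_sharp (hcov : IsMetric cov) (hβ : ∀ x, MDiffAt (T% (sharp β)) x)
    (hK0 : K ≠ 0) (hK : ∀ x, ‖sharp β x‖ = K) (x : M) (X : TangentSpace I x) :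
    correction cov β K x X (sharp β x) = -cov (sharp β) x X :=
  skewCorrection_apply_self hK0 (hK x) (inner_cov_sharp_eq_zero hcov hβ hK x X)

theorem isUniqueOptimum_correction (hcov : IsMetric cov) (hβ : ∀ x, MDiffAt (T% (sharp β)) x)
    (hK0 : K ≠ 0) (hK : ∀ x, ‖sharp β x‖ = K) (x : M) (X : TangentSpace I x) :
    IsUniqueOptimum cov β X (correction cov β K x X) := by
  have hb := correction_apply_sharp hcov hβ hK0 hK x X
  refine ⟨⟨inner_skewCorrection _ _ _ X, hb⟩, fun L hL hne ↦ ?_⟩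
  rw [tensorNormSq_eq_sum_sq_norm, tensorNormSq_eq_sum_sq_norm]
  exact sum_sq_norm_lt_of_skew _ hL.1 (hL.2.trans hb.symm) hne

variable (cov β K) in
/-- The connection `∇ + A`, where `A` is the correction term. -/
def correctedConnection : CovariantDerivative I E (TangentSpace I : M → Type _) :=
  -- The one-form takes the value of the section first and the direction second, hence the flip.
  cov.addOneForm fun x ↦ (correction cov β K x).flip

theorem correctedConnection_apply (Y : Π x : M, TangentSpace I x) (x : M) (X : TangentSpace I x) :
    correctedConnection cov β K Y x X = cov Y x X + correction cov β K x X (Y x) :=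
  rfl

/-- The two correction terms cancel because `Y ↦ A(X, Y)` is skew; the length of `β♯` plays no role
here. -/
theorem isMetric_correctedConnection (hcov : IsMetric cov) :
    IsMetric (correctedConnection cov β K) := by
  intro x X Y Z hY hZ
  rw [hcov x X Y Z hY hZ, correctedConnection_apply, correctedConnection_apply, inner_add_left,
    inner_add_right, real_inner_comm (correction cov β K x X (Z x)) (Y x)]
  have h : inner ℝ (correction cov β K x X (Y x)) (Z x)
      = -inner ℝ (correction cov β K x X (Z x)) (Y x) := inner_skewCorrection ..
  rw [h]
  ring

theorem correctedConnection_sharp (hcov : IsMetric cov) (hβ : ∀ x, MDiffAt (T% (sharp β)) x)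
    (hK0 : K ≠ 0) (hK : ∀ x, ‖sharp β x‖ = K) (x : M) (X : TangentSpace I x) :
    correctedConnection cov β K (sharp β) x X = 0 := by
  rw [correctedConnection_apply, correction_apply_sharp hcov hβ hK0 hK, add_neg_cancel]

section Smooth

variable [ContMDiffVectorBundle ∞ E (TangentSpace I : M → Type _) I]
  [IsContMDiffRiemannianBundle I ∞ E (fun x : M ↦ TangentSpace I x)]

theorem contMDiff_correctedConnection (hcov : cov.ContMDiffCovariantDerivative ∞)
    (hβ : CMDiff ∞ (T% (sharp β))) :
    (correctedConnection cov β K).ContMDiffCovariantDerivative ∞ := by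
  refine ⟨⟨fun {σ} hσ ↦ ?_⟩⟩
  rw [contMDiffOn_univ] at hσ ⊢
  intro p
  refine contMDiffAt_hom_of_apply_constField fun w ↦ ?_
  have hw : CMDiffAt ∞ (T% (constField (I := I) p w)) p :=
    contMDiffAt_constField (mem_baseSet_self p) w
  have cov_smooth {τ : Π x : M, TangentSpace I x} (hτ : CMDiff ∞ (T% τ)) :
      CMDiffAt ∞ (T% (fun x ↦ cov τ x (constField p w x))) p := by
    have h := hcov.contMDiff.contMDiff (σ := τ) (contMDiffOn_univ.2 hτ)
    exact ((contMDiffOn_univ.1 h) p).clm_bundle_apply (F₁ := E)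
      (E₁ := (TangentSpace I : M → Type _)) (E₂ := (TangentSpace I : M → Type _)) hw
  have inner_smooth {U V : Π x : M, TangentSpace I x} (hU : CMDiffAt ∞ (T% U) p)
      (hV : CMDiffAt ∞ (T% V) p) : CMDiffAt ∞ (fun x ↦ (inner ℝ (U x) (V x) / K ^ 2 : ℝ)) p :=
    (contMDiffAt_inner (V := fun x : M ↦ TangentSpace I x) hU hV).div_const _
  have h := (cov_smooth hσ).add_section
    (((inner_smooth (cov_smooth hβ) (hσ p)).smul_section (hβ p)).sub_section
      ((inner_smooth (hσ p) (hβ p)).smul_section (cov_smooth hβ)))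
  refine h.congr_of_eventuallyEq (Filter.Eventually.of_forall fun x ↦ ?_)
  dsimp only
  rw [correctedConnection_apply, correction_apply]
  rfl

end Smooth

end

/-! ### Vanishing one-forms -/

section

variable {E : Type*} [NormedAddCommGroup E] [NormedSpace ℝ E] [FiniteDimensional ℝ E]
  {H : Type*} [TopologicalSpace H] {I : ModelWithCorners ℝ E H}
  {M : Type*} [TopologicalSpace M] [ChartedSpace H M] [IsManifold I 1 M]
  [RiemannianBundle (fun x : M ↦ TangentSpace I x)]
  [IsContMDiffRiemannianBundle I ∞ E (fun x : M ↦ TangentSpace I x)]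

omit [FiniteDimensional ℝ E] in
variable (I M) in
theorem isRiemannianNorm_sqrt_inner :
    IsRiemannianNorm (fun (x : M) (v : TangentSpace I x) ↦ √(inner ℝ v v)) := by
  obtain ⟨g, hg, hinner⟩ := IsContMDiffRiemannianBundle.exists_contMDiff (IB := I) (n := ∞)
    (F := E) (E := fun x : M ↦ TangentSpace I x)
  refine ⟨{ inner := g
            symm := fun x v w ↦ ?_
            pos := fun x v hv ↦ ?_
            isVonNBounded := fun x ↦ ?_
            contMDiff := hg }, fun x v ↦ congrArg _ (hinner x v v)⟩
  · rw [← hinner, ← hinner]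
    exact real_inner_comm w v
  · rw [← hinner]
    exact real_inner_self_pos.2 hv
  -- The set `α(v, v) < 1` is the unit ball of the norm of `T_x M`.
  · refine (NormedSpace.isVonNBounded_ball ℝ (TangentSpace I x) 1).subset fun v hv ↦ ?_
    have hv' : inner ℝ v v < (1 : ℝ) := (hinner x v v).trans_lt hv
    rw [real_inner_self_eq_norm_sq] at hv'
    rw [mem_ball_zero_iff]
    exact (sq_lt_one_iff₀ (norm_nonneg v)).1 hv'

/-- This excludes `K = 0` for a non-Riemannian `F`. -/
theorem isRiemannianNorm_of_sharp_eq_zero {β : Π x : M, TangentSpace I x →L[ℝ] ℝ}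
    (hβ : ∀ x, ‖sharp β x‖ = 0) :
    IsRiemannianNorm (fun (x : M) (v : TangentSpace I x) ↦ √(inner ℝ v v) + β x v) := by
  have h : (fun (x : M) (v : TangentSpace I x) ↦ √(inner ℝ v v) + β x v)
      = fun (x : M) (v : TangentSpace I x) ↦ √(inner ℝ v v) := by
    funext x v
    rw [← inner_sharp, norm_eq_zero.1 (hβ x), inner_zero_left, add_zero]
  rw [h]
  exact isRiemannianNorm_sqrt_inner I M

end

end Randers

end

/-! ### The equivalence and the optimal connection -/

theorem mainTheorem2 {E : Type*} [NormedAddCommGroup E] [NormedSpace ℝ E] [FiniteDimensional ℝ E]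
    {M : Type*} [TopologicalSpace M] [ChartedSpace E M] [IsManifold 𝓘(ℝ, E) ∞ M]
    [T2Space M] [ConnectedSpace M]
    [RiemannianBundle (fun x : M ↦ TangentSpace 𝓘(ℝ, E) x)]
    [IsContMDiffRiemannianBundle 𝓘(ℝ, E) ∞ E (fun x : M ↦ TangentSpace 𝓘(ℝ, E) x)]
    (β : Randers.RandersForm 𝓘(ℝ, E) M) (hβ : ¬ Randers.IsRiemannianNorm β.metric) :
    ((∃ cov : CovariantDerivative 𝓘(ℝ, E) E (TangentSpace 𝓘(ℝ, E) : M → Type _),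
        cov.ContMDiffCovariantDerivative ∞ ∧ Randers.IsCompatible cov β.metric) ↔
      ∃ K : ℝ, K ≠ 0 ∧ ∀ x, ‖Randers.sharp β.form x‖ = K) ∧
    (∃ lc : CovariantDerivative 𝓘(ℝ, E) E (TangentSpace 𝓘(ℝ, E) : M → Type _),
      Randers.IsLeviCivita lc) ∧
    ∀ K : ℝ, K ≠ 0 → (∀ x, ‖Randers.sharp β.form x‖ = K) →
      ∀ lc : CovariantDerivative 𝓘(ℝ, E) E (TangentSpace 𝓘(ℝ, E) : M → Type _),
        Randers.IsLeviCivita lc →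
        ∃ A : Π x : M, TangentSpace 𝓘(ℝ, E) x →L[ℝ]
            TangentSpace 𝓘(ℝ, E) x →L[ℝ] TangentSpace 𝓘(ℝ, E) x,
          (∀ (x : M) (X Y : TangentSpace 𝓘(ℝ, E) x),
            A x X Y
              = (inner ℝ (lc (Randers.sharp β.form) x X) Y / K ^ 2) • Randers.sharp β.form x
                - (inner ℝ Y (Randers.sharp β.form x) / K ^ 2) •
                  lc (Randers.sharp β.form) x X) ∧
          (∀ (x : M) (X : TangentSpace 𝓘(ℝ, E) x),
            Randers.IsUniqueOptimum lc β.form X (A x X)) ∧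
          ∃ cov : CovariantDerivative 𝓘(ℝ, E) E (TangentSpace 𝓘(ℝ, E) : M → Type _),
            (∀ (Y : Π x : M, TangentSpace 𝓘(ℝ, E) x) (x : M) (X : TangentSpace 𝓘(ℝ, E) x),
              cov Y x X = lc Y x X + A x X (Y x)) ∧
            cov.ContMDiffCovariantDerivative ∞ ∧ Randers.IsCompatible cov β.metric := by
  have : ContMDiffVectorBundle ∞ E (TangentSpace 𝓘(ℝ, E) : M → Type _) 𝓘(ℝ, E) :=
    have : IsManifold 𝓘(ℝ, E) (∞ + 1) M := inferInstanceAs (IsManifold 𝓘(ℝ, E) ∞ M)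
    inferInstance
  have hsmooth : CMDiff ∞ (T% (Randers.sharp β.form)) := Randers.contMDiff_sharp β.contMDiff
  have hdiff (x : M) : MDiffAt (T% (Randers.sharp β.form)) x :=
    (hsmooth x).mdifferentiableAt (by simp)
  -- Serves both the existence half of the equivalence and the final claim about an arbitrary
  -- Levi-Civita connection.
  have corrected {K : ℝ} (hK0 : K ≠ 0) (hK : ∀ x, ‖Randers.sharp β.form x‖ = K)
      {lc : CovariantDerivative 𝓘(ℝ, E) E (TangentSpace 𝓘(ℝ, E) : M → Type _)}
      (hlc : Randers.IsLeviCivita lc) :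
      (Randers.correctedConnection lc β.form K).ContMDiffCovariantDerivative ∞ ∧
        Randers.IsCompatible (Randers.correctedConnection lc β.form K) β.metric :=
    ⟨Randers.contMDiff_correctedConnection hlc.smooth hsmooth,
      Randers.isCompatible_of_isMetric (Randers.isMetric_correctedConnection hlc.metric) hdiff
        (Randers.correctedConnection_sharp hlc.metric hdiff hK0 hK)⟩
  have hlc : Randers.IsLeviCivita (Randers.leviCivita (I := 𝓘(ℝ, E)) (M := M)) :=
    Randers.isLeviCivita_leviCivita
  refine ⟨⟨?_, fun ⟨K, hK0, hK⟩ ↦ ⟨_, corrected hK0 hK hlc⟩⟩, ⟨_, hlc⟩, fun K hK0 hK lc hlc ↦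
    ⟨Randers.correction lc β.form K, Randers.correction_apply,
      Randers.isUniqueOptimum_correction hlc.metric hdiff hK0 hK,
      Randers.correctedConnection lc β.form K, Randers.correctedConnection_apply,
      corrected hK0 hK hlc⟩⟩
  rintro ⟨cov, hcov, hcomp⟩
  obtain ⟨K, hK⟩ := Randers.exists_norm_sharp_eq hcov hcomp
  refine ⟨K, ?_, hK⟩
  rintro rfl
  exact hβ (Randers.isRiemannianNorm_of_sharp_eq_zero hK)
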